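/- **Theorem (Recovery after the occurrence of transient faults).** *Setting.* There are $N\ge 2$ nodes $p_1,\dots,p_N$; each hosts a server and at most one client at a time. Let $f,e\ge 0$, $k\ge 1$ with $k+2(f+e)\le N$; a quorum is a set of at least $\lceil (N+k+2e)/2\rceil$ servers. Tags are pairs $(z,j)$ (a number and a node identifier), ordered lexicographically, with least element $t_0$. Nodes exchange messages over reliable FIFO channels, one for each ordered pair of distinct nodes. *The algorithm.* A server stores a finite set $S$ of records (tag, word or $\bot$, phase), with phases `pre', `fin', `FIN'. A call of $\mathrm{qrmAccess}(m)$ sends the request $m$ to the servers (possibly repeatedly) until acknowledgments of $m$ from a quorum have been received, and then returns them. A writer at $p_i$ queries a quorum for the maximal stored tag $(z,j)$, and then makes three more calls with the tag $(z+1,i)$: pre-write (which also carries to each server its share of the encoded secret), finalize (`fin') and FINALIZE (`FIN'). A reader queries a quorum for the maximal tag $t$ of phase `fin' or `FIN', then calls finalize with $t$, and decodes the shares that it receives. A server answers queries by its maximal tag ($t_0$ if it has none), and on each other request it inserts or updates the record with the tag of the request; at most $e$ servers may corrupt the shares that they send to readers. Servers keep gossiping their triples of maximal tags over all phases, over $\{$`fin',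 `FIN'$\}$, and over $\{$`FIN'$\}$; when gossip arrives, a server inserts or updates the records of the maximal tags of each phase that are known to it from its storage and from the last gossip of every server (a tag that a quorum reports as its maximal finalized tag counts as FINALIZED), and renews its own gossip message. *Executions.* An execution is an infinite sequence $R=c_0,a_0,c_1,a_1,\dots$ of system states and atomic steps; $c_0$ is arbitrary. $R$ is *fair* if every step, other than the invocation of an operation, that is applicable infinitely often is taken infinitely often. $R$ is *legal with respect to the gossip and quorum services* if (a) for all distinct servers $p_j,p_l$, every gossip message from $p_j$ that is delivered at $p_l$ was sent by $p_j$ earlier in $R$, and such deliveries occur infinitely often; and (b) every call of $\mathrm{qrmAccess}$ in $R$ returns, and it returns only after a quorum of servers has received, delivered and acknowledged the request of that call and the client has received these acknowledgments. *Cycles.* The first asynchronous cycle of an execution is its shortest prefix in which (i) for every server $p_i$, first a gossip message from another server arrives at $p_i$, and then, for every other $p_j$, a gossip message sent thereafter by $p_i$ arrives at $p_j$ and a gossip message sent thereafter by $p_j$ arrives at $p_i$; and (ii) every node that runs a client in the prefix completes in it at least one client round (one return of $\mathrm{qrmAccess}$). Further cycles are defined by iterating this on the remaining suffix. *Operations.*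 An operation consists of the steps of one run of a client procedure, including the receptions of its requests by servers and of the replies by the client. It is *incomplete* if its first step in $R$ is not the first line of its procedure, i.e., it stems from the starting state (the client is running, or its requests or replies to it are in transit, in $c_0$); it is *complete* if its run starts with the first line and ends with the last line of the procedure. Let $T(c)$ be the set of tags that appear in state $c$, in the nodes or in transit. A write operation $\pi$ with tag $T(\pi)$ (the tag of its pre-write) is *valid* if it is complete and there is a state $c$ in $R$ before the starting state of $\pi$ such that $T(\pi)>t$ for every $t\in T(c_0)\cap T(c)$. *Claim.* There are absolute constants $C_1,C_2$ such that for all $N,k,e,f$ as above, every coding scheme, and every fair execution $R$ of the algorithm that is legal with respect to the gossip and quorum services and has an arbitrary starting state, the following holds. Within $C_1$ asynchronous cycles, $R$ reaches a suffix $R'$ that includes no (part of an) incomplete operation. Within $C_2$ further asynchronous cycles, counted from the start of $R'$, $R'$ reaches a suffix $R''$ such that every write operation of which $R''$ includes a part is valid. -/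

import Mathlib

universe u v

namespace CAS

noncomputable section

open scoped Classical

/-! ### Tags, records, messages -/

/-- Tags `(z, j)`: a sequence number and a node identifier, ordered lexicographically.
The default tag `t₀` is the least tag `⊥ = (0, 0)`. -/
abbrev Tag (N : ℕ) : Type := ℕ ×ₗ Fin N

/-- A quorum is a set of at least `⌈(N + k + 2e) / 2⌉` servers. -/
def IsQuorum {N : ℕ} (k e : ℕ) (A : Finset (Fin N)) : Prop :=
  N + k + 2 * e ≤ 2 * A.card

/-- The coding scheme `Φ` (every `k + 2e` shares, at most `e` of them corrupted, determine the
secret) together with the set of servers that may corrupt the shares they send to readers. -/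
structure Setup (N k e : ℕ) (Sec : Type u) (Word : Type v) where
  encode : Sec → Fin N → Word
  decode : (Fin N → Option Word) → Sec
  decode_encode : ∀ (s : Sec) (sh : Fin N → Option Word),
    k + 2 * e ≤ (Finset.univ.filter fun j => sh j ≠ none).card →
    (Finset.univ.filter fun j => ∃ w, sh j = some w ∧ w ≠ encode s j).card ≤ e →
    decode sh = s
  corrupt : Finset (Fin N)
  corrupt_card : corrupt.card ≤ e

inductive Phase : Type
  | pre
  | fin
  | FIN

inductive Role : Type
  | writer
  | reader

/-- A storage record `(t, w, d)`; the word `none` is `⊥`. -/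
structure Record (N : ℕ) (Word : Type v) where
  tag : Tag N
  word : Option Word
  phase : Phase

/-- A gossip message (write tag, read tag, anchor tag). -/
structure Triple (N : ℕ) where
  pre : Tag N
  fin : Tag N
  FIN : Tag N

def Triple.tags {N : ℕ} (g : Triple N) : Set (Tag N) := {g.pre, g.fin, g.FIN}

/-- A client request to a server: query, pre-write `(t, w, 'pre')`, finalize `(t, ⊥, 'fin')`,
FINALIZE `(t, ⊥, 'FIN')`. -/
inductive Request (N : ℕ) (Word : Type v) : Type v
  | qry (r : Role)
  | pre (t : Tag N) (w : Option Word)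
  | fin (r : Role) (t : Tag N)
  | FIN (r : Role) (t : Tag N)

def Request.tags {N : ℕ} {Word : Type v} : Request N Word → Set (Tag N)
  | .qry _ => ∅
  | .pre t _ => {t}
  | .fin _ t => {t}
  | .FIN _ t => {t}

structure Reply (N : ℕ) (Word : Type v) where
  tag : Tag N
  word : Option Word

/-- Messages in transit. An acknowledgment carries the request that it answers. -/
inductive Msg (N : ℕ) (Word : Type v) : Type v
  | gossip (g : Triple N)
  | request (q : Request N Word)
  | ack (q : Request N Word) (a : Reply N Word)

def Msg.tags {N : ℕ} {Word : Type v} : Msg N Word → Set (Tag N)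
  | .gossip g => g.tags
  | .request q => q.tags
  | .ack q a => insert a.tag q.tags

/-! ### The server -/

section Server

variable {N : ℕ} {Word : Type v}

def upgradePhase : Phase → Phase → Phase
  | .pre, .fin => .fin
  | .fin, .FIN => .FIN
  | old, _ => old

/-- `updatePhase(t, w, u)` turns the storage `S` into `S'`. It is a relation, since an arbitrary
storage may hold several records with the tag `t`. -/
def UpdatePhase (S : Finset (Record N Word)) (t : Tag N) (w : Option Word) (d : Phase)
    (S' : Finset (Record N Word)) : Prop :=
  (∃ s ∈ S, s.tag = t ∧ s.word ≠ none ∧ w = none ∧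
      S' = insert ⟨t, s.word, upgradePhase s.phase d⟩ (S.erase s)) ∨
  ((¬ ∃ s ∈ S, s.tag = t ∧ s.word ≠ none ∧ w = none) ∧
      S' = insert ⟨t, w, d⟩ (S.filter fun s => s.tag ≠ t))

variable [NeZero N]

/-- `maxPhase(D)`: the maximal stored tag with a phase in `D`, and `t₀ = ⊥` if there is none. -/
def maxPhase (S : Finset (Record N Word)) (D : Set Phase) : Tag N :=
  (S.filter fun s => s.phase ∈ D).sup Record.tag

def tagTuple (S : Finset (Record N Word)) : Triple N :=
  ⟨maxPhase S Set.univ, maxPhase S {Phase.fin, Phase.FIN}, maxPhase S {Phase.FIN}⟩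

/-- The reply to a finalize or FINALIZE request with the tag `t` and the phase `d`. A corrupting
server may send any word to a reader. -/
def FinReply (corrupt : Prop) (S : Finset (Record N Word)) (r : Role) (t : Tag N) (d : Phase)
    (a : Reply N Word) : Prop :=
  a.tag = t ∧
  match r with
  | .writer => a.word = none
  | .reader => corrupt ∨ (∃ s ∈ S, s.tag = t ∧ s.phase = d ∧ a.word = s.word) ∨
      ((¬ ∃ s ∈ S, s.tag = t ∧ s.phase = d) ∧ a.word = none)

/-- The server handles a client request: storage `S` becomes `S'` and the reply is `a`. -/
def Serve (corrupt : Prop) (S : Finset (Record N Word)) (q : Request N Word)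
    (S' : Finset (Record N Word)) (a : Reply N Word) : Prop :=
  match q with
  | .qry .reader => S' = S ∧ a = ⟨maxPhase S {Phase.fin, Phase.FIN}, none⟩
  | .qry .writer => S' = S ∧ a = ⟨maxPhase S Set.univ, none⟩
  | .pre t w => UpdatePhase S t w .pre S' ∧ a = ⟨t, none⟩
  | .fin r t => UpdatePhase S t none .fin S' ∧ FinReply corrupt S' r t .fin a
  | .FIN r t => UpdatePhase S t none .FIN S' ∧ FinReply corrupt S' r t .FIN a

/-- The gossip handler of the server at `i`, where `g` holds the most recently received gossip
message of every server (and the values that `i` itself aggregated, as `g i`): the storage `S`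
becomes `S'` and the new value of `g i` is `m`. -/
def GossipUpdate (k e : ℕ) (i : Fin N) (g : Fin N → Triple N)
    (S S' : Finset (Record N Word)) (m : Triple N) : Prop :=
  ∃ S₁ S₂ : Finset (Record N Word),
    m.pre = (Finset.univ.sup fun l => (g l).pre ⊔ (g l).fin ⊔ (g l).FIN) ⊔
      maxPhase S Set.univ ∧
    UpdatePhase S m.pre none .pre S₁ ∧
    m.fin = (Finset.univ.sup fun l => (g l).fin ⊔ (g l).FIN) ⊔
      maxPhase S₁ {Phase.fin, Phase.FIN} ∧
    UpdatePhase S₁ m.fin none .fin S₂ ∧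
    m.FIN = (Finset.univ.sup fun l => (g l).FIN) ⊔ maxPhase S₂ {Phase.FIN} ⊔
      (Finset.univ.filter fun l => IsQuorum k e (Finset.univ.filter fun l' =>
          (Function.update g i ⟨m.pre, m.fin, (g i).FIN⟩ l').fin =
            (Function.update g i ⟨m.pre, m.fin, (g i).FIN⟩ l).fin)).sup
        (fun l => (Function.update g i ⟨m.pre, m.fin, (g i).FIN⟩ l).fin) ∧
    UpdatePhase S₂ m.FIN none .FIN S'

end Server

/-! ### The client -/

/-- The round (call of `qrmAccess`) in which a running client is: the query, pre-write, finalize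
and FINALIZE rounds of a writer, the query and finalize rounds of a reader. -/
inductive Round (N : ℕ) (Sec : Type u) : Type u
  | wQry (s : Sec)
  | wPre (s : Sec) (t : Tag N)
  | wFin (t : Tag N)
  | wFIN (t : Tag N)
  | rQry
  | rFin (t : Tag N)

def Round.IsWrite {N : ℕ} {Sec : Type u} : Round N Sec → Prop
  | .wQry _ => True
  | .wPre _ _ => True
  | .wFin _ => True
  | .wFIN _ => True
  | .rQry => False
  | .rFin _ => False

def Round.tags {N : ℕ} {Sec : Type u} : Round N Sec → Set (Tag N)
  | .wQry _ => ∅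
  | .wPre _ t => {t}
  | .wFin t => {t}
  | .wFIN t => {t}
  | .rQry => ∅
  | .rFin t => {t}

/-- The request that a client sends to the server at `j` in a round. -/
def Round.request {N k e : ℕ} {Sec : Type u} {Word : Type v} (P : Setup N k e Sec Word)
    (j : Fin N) : Round N Sec → Request N Word
  | .wQry _ => .qry .writer
  | .wPre s t => .pre t (some (P.encode s j))
  | .wFin t => .fin .writer t
  | .wFIN t => .FIN .writer t
  | .rQry => .qry .reader
  | .rFin t => .fin .reader t

/-- A node runs no client, or one client that waits in a round for the acknowledgments of a quorum
and has collected `acks` so far. -/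
inductive Client (N : ℕ) (Sec : Type u) (Word : Type v) : Type (max u v)
  | idle
  | busy (r : Round N Sec) (acks : Fin N → Option (Reply N Word))

def Client.tags {N : ℕ} {Sec : Type u} {Word : Type v} : Client N Sec Word → Set (Tag N)
  | .idle => ∅
  | .busy r acks => r.tags ∪ {t | ∃ j a, acks j = some a ∧ a.tag = t}

/-- The maximal tag in the collected acknowledgments. -/
def maxAck {N : ℕ} [NeZero N] {Word : Type v} (acks : Fin N → Option (Reply N Word)) : Tag N :=
  Finset.univ.sup fun j => ((acks j).map Reply.tag).getD ⊥

/-- What the client at `i` does when `qrmAccess` returns: it calls `qrmAccess` for its next round,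
or its procedure ends. -/
def nextClient {N : ℕ} [NeZero N] {Sec : Type u} {Word : Type v} (i : Fin N) (r : Round N Sec)
    (acks : Fin N → Option (Reply N Word)) : Client N Sec Word :=
  match r with
  | .wQry s => .busy (.wPre s (toLex ((ofLex (maxAck acks)).1 + 1, i))) fun _ => none
  | .wPre _ t => .busy (.wFin t) fun _ => none
  | .wFin t => .busy (.wFIN t) fun _ => none
  | .wFIN _ => .idle
  | .rQry => .busy (.rFin (maxAck acks)) fun _ => none
  | .rFin _ => .idle

/-- The value that a reader returns: the decoded secret, or `none` (`⊥`) if there are too few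
shares. -/
def readResult {N k e : ℕ} {Sec : Type u} {Word : Type v} (P : Setup N k e Sec Word)
    (acks : Fin N → Option (Reply N Word)) : Option Sec :=
  if k + 2 * e ≤ (Finset.univ.filter fun j => (acks j).bind Reply.word ≠ none).card then
    some (P.decode fun j => (acks j).bind Reply.word)
  else none

/-! ### System states and steps -/

/-- A system state. `gossip i l` is the gossip message that the server at `i` received last from the
server at `l ≠ i`, and `gossip i i` holds its own aggregated values `(pre[i], fin[i], FIN[i])`;
`gossipTx i` is the argument of its last call of `gossip()`; `output i` is the last value that a
reader at `i` returned; for `i ≠ j`, `chan i j` is the (reliable, FIFO) channel from `i` to `j`,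
oldest message first. -/
structure State (N : ℕ) (Sec : Type u) (Word : Type v) where
  store : Fin N → Finset (Record N Word)
  gossip : Fin N → Fin N → Triple N
  gossipTx : Fin N → Triple N
  client : Fin N → Client N Sec Word
  output : Fin N → Option Sec
  chan : Fin N → Fin N → List (Msg N Word)

/-- All tags that appear in a system state: in the storages, in the other server variables, in the
clients, and in the messages in transit. -/
def State.tags {N : ℕ} {Sec : Type u} {Word : Type v} (c : State N Sec Word) : Set (Tag N) :=
  {t | (∃ i, ∃ s ∈ c.store i, s.tag = t) ∨ (∃ i l, t ∈ (c.gossip i l).tags) ∨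
    (∃ i, t ∈ (c.gossipTx i).tags) ∨ (∃ i, t ∈ (c.client i).tags) ∨
    ∃ i j, i ≠ j ∧ ∃ m ∈ c.chan i j, t ∈ m.tags}

/-- The kinds of steps. `requestSend i j`: the quorum service at `i` transmits the current request
of `i`'s client to the server at `j ≠ i`; `localAccess i`: it passes that request to the server at
`i` itself; `ret i`: `qrmAccess` returns at `i`; `gossipSend i j`: the gossip service at `i`
transmits to `j`; `recv i j`: node `j` receives the oldest message of the channel from `i`. -/
inductive Action (N : ℕ) (Sec : Type u) : Type u
  | invokeWrite (i : Fin N) (s : Sec)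
  | invokeRead (i : Fin N)
  | requestSend (i j : Fin N)
  | localAccess (i : Fin N)
  | ret (i : Fin N)
  | gossipSend (i j : Fin N)
  | recv (i j : Fin N)

def Action.IsInvocation {N : ℕ} {Sec : Type u} : Action N Sec → Prop
  | .invokeWrite _ _ => True
  | .invokeRead _ => True
  | _ => False

/-- Replace the content of the channel from `i` to `j` by `l`. -/
def setChan {N : ℕ} {α : Type v} (ch : Fin N → Fin N → α) (i j : Fin N) (l : α) :
    Fin N → Fin N → α :=
  Function.update ch i (Function.update (ch i) j l)

section Steps

variable {N k e : ℕ} [NeZero N] {Sec : Type u} {Word : Type v}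

/-- The client collects an acknowledgment of its current request and ignores any other. -/
def collect (P : Setup N k e Sec Word) (i : Fin N) (q : Request N Word) (a : Reply N Word) :
    Client N Sec Word → Client N Sec Word
  | .idle => .idle
  | .busy r acks =>
    if r.request P i = q then .busy r (Function.update acks i (some a)) else .busy r acks

/-- Node `j` receives the message `m`, the head of the channel from `i`, whose remainder is `l`. -/
def Receive (P : Setup N k e Sec Word) (c : State N Sec Word) (i j : Fin N) (m : Msg N Word)
    (l : List (Msg N Word)) (c' : State N Sec Word) : Prop :=
  match m with
  | .gossip g => ∃ (S' : Finset (Record N Word)) (m' : Triple N),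
      GossipUpdate k e j (Function.update (c.gossip j) i g) (c.store j) S' m' ∧
      c' = { c with
        store := Function.update c.store j S'
        gossip := Function.update c.gossip j
          (Function.update (Function.update (c.gossip j) i g) j m')
        gossipTx := Function.update c.gossipTx j (tagTuple S')
        chan := setChan c.chan i j l }
  | .request q => ∃ (S' : Finset (Record N Word)) (a : Reply N Word),
      Serve (j ∈ P.corrupt) (c.store j) q S' a ∧
      c' = { c with
        store := Function.update c.store j S'
        chan := setChan (setChan c.chan i j l) j i (c.chan j i ++ [.ack q a]) }
  | .ack q a =>
      c' = { c with
        client := Function.update c.client j (collect P i q a (c.client j))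
        chan := setChan c.chan i j l }

/-- The step relation of the algorithm over the gossip and quorum services. -/
def Step (P : Setup N k e Sec Word) (c : State N Sec Word) (x : Action N Sec)
    (c' : State N Sec Word) : Prop :=
  match x with
  | .invokeWrite i s => c.client i = .idle ∧
      c' = { c with client := Function.update c.client i (.busy (.wQry s) fun _ => none) }
  | .invokeRead i => c.client i = .idle ∧
      c' = { c with client := Function.update c.client i (.busy .rQry fun _ => none) }
  | .requestSend i j => i ≠ j ∧ ∃ r acks, c.client i = .busy r acks ∧
      c' = { c with chan := setChan c.chan i j (c.chan i j ++ [.request (r.request P j)]) }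
  | .localAccess i => ∃ r acks, c.client i = .busy r acks ∧
      ∃ (S' : Finset (Record N Word)) (a : Reply N Word),
        Serve (i ∈ P.corrupt) (c.store i) (r.request P i) S' a ∧
        c' = { c with
          store := Function.update c.store i S'
          client := Function.update c.client i
            (.busy r (Function.update acks i (some a))) }
  | .ret i => ∃ r acks, c.client i = .busy r acks ∧
      IsQuorum k e (Finset.univ.filter fun j => acks j ≠ none) ∧
      c' = { c with
        client := Function.update c.client i (nextClient i r acks)
        output := match r with
          | .rFin _ => Function.update c.output i (readResult P acks)
          | _ => c.output }
  | .gossipSend i j => i ≠ j ∧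
      c' = { c with chan := setChan c.chan i j (c.chan i j ++ [.gossip (c.gossipTx i)]) }
  | .recv i j => i ≠ j ∧ ∃ m l, c.chan i j = m :: l ∧ Receive P c i j m l c'

/-! ### Executions, fairness -/

/-- An (unbounded) execution `c₀, a₀, c₁, a₁, …`, with an arbitrary starting system state. -/
structure Execution (P : Setup N k e Sec Word) where
  st : ℕ → State N Sec Word
  act : ℕ → Action N Sec
  step : ∀ n, Step P (st n) (act n) (st (n + 1))

namespace Execution

variable {P : Setup N k e Sec Word} (R : Execution P)

/-- Every step that is applicable infinitely often is taken infinitely often. The invocation of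
operations is up to the environment. -/
def Fair : Prop :=
  ∀ x : Action N Sec, ¬ x.IsInvocation →
    (∀ m, ∃ n, m ≤ n ∧ ∃ c', Step P (R.st n) x c') → ∀ m, ∃ n, m ≤ n ∧ R.act n = x

/-- The message that step `s` puts into the channel from `i` to `j` is the one that is received in
step `d`: the channel being FIFO, as many messages are received from step `s + 1` to step `d` as
the channel holds right after step `s`. -/
def ReceivedAt (i j : Fin N) (s d : ℕ) : Prop :=
  s < d ∧ R.act d = .recv i j ∧
    ((Finset.Ioo s d).filter fun p => R.act p = .recv i j).card + 1 =
      ((R.st (s + 1)).chan i j).length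

/-- Step `d` receives a message that the channel from `i` to `j` holds in the starting state. -/
def ReceivesInitial (i j : Fin N) (d : ℕ) : Prop :=
  R.act d = .recv i j ∧
    ((Finset.range d).filter fun p => R.act p = .recv i j).card < ((R.st 0).chan i j).length

/-- In step `n`, node `j` receives the gossip message `g` from `i`. -/
def DeliversGossip (i j : Fin N) (g : Triple N) (n : ℕ) : Prop :=
  R.act n = .recv i j ∧ ((R.st n).chan i j).head? = some (.gossip g)

/-! ### Legal executions of the gossip and quorum services -/

/-- Correct gossip from `i` to `j`: every delivered message was sent by `i` earlier, and deliveries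
occur infinitely often. -/
def GossipCorrect (i j : Fin N) : Prop :=
  (∀ n g, R.DeliversGossip i j g n →
    ∃ s < n, R.act s = .gossipSend i j ∧ (R.st s).gossipTx i = g) ∧
  ∀ m, ∃ n g, m ≤ n ∧ R.DeliversGossip i j g n

/-- In step `a` the client at `i` calls `qrmAccess`. -/
def CallsQrm (i : Fin N) (a : ℕ) : Prop :=
  ((∃ s, R.act a = .invokeWrite i s) ∨ R.act a = .invokeRead i ∨ R.act a = .ret i) ∧
    (R.st (a + 1)).client i ≠ .idle

/-- Between the steps `a` and `b`, the server at `j` receives, delivers and acknowledges a request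
that the client at `i` sends after `a`, and the client receives that acknowledgment. -/
def Served (i j : Fin N) (a b : ℕ) : Prop :=
  (i = j ∧ ∃ d, a < d ∧ d < b ∧ R.act d = .localAccess i) ∨
  (i ≠ j ∧ ∃ s d x, a < s ∧ R.act s = .requestSend i j ∧ R.ReceivedAt i j s d ∧
    R.ReceivedAt j i d x ∧ x < b)

/-- Correct quorum-based communication of the client at `i`: every call of `qrmAccess` returns, and
it returns only after a quorum of servers has received, delivered and acknowledged the request of
that call and the client has received these acknowledgments. -/
def QuorumCorrect (i : Fin N) : Prop :=
  ∀ a, R.CallsQrm i a → ∃ b, a < b ∧ R.act b = .ret i ∧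
    (∀ p, a < p → p < b → R.act p ≠ .ret i) ∧
    ∃ Q : Finset (Fin N), IsQuorum k e Q ∧ ∀ j ∈ Q, R.Served i j a b

/-- The execution is legal with respect to the gossip and quorum services. (That a node runs at most
one client, which calls `qrmAccess` sequentially, and that servers acknowledge every request holds
by construction of the steps.) -/
def Legal : Prop :=
  (∀ i j, i ≠ j → R.GossipCorrect i j) ∧ ∀ i, R.QuorumCorrect i

/-! ### Asynchronous cycles -/

/-- The steps `m, …, n - 1` include a complete iteration of the server at `i`: it gets a gossip
message from another server, afterwards it sends a message to every other server `j`, which `j`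
receives, and a message that `j` sends thereafter arrives back at `i`. -/
def ServerIteration (i : Fin N) (m n : ℕ) : Prop :=
  ∃ a, m ≤ a ∧ (∃ l g, l ≠ i ∧ R.DeliversGossip l i g a) ∧
    ∀ j, j ≠ i → ∃ b b' d d', a < b ∧ R.act b = .gossipSend i j ∧ R.ReceivedAt i j b b' ∧
      b' < d ∧ R.act d = .gossipSend j i ∧ R.ReceivedAt j i d d' ∧ d' < n

/-- In the steps `m, …, n - 1` every server has a complete iteration, and every node that runs a
client completes at least one client round. -/
def Covers (m n : ℕ) : Prop :=
  (∀ i, R.ServerIteration i m n) ∧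
  ∀ i, (∃ p, m ≤ p ∧ p < n ∧ (R.st p).client i ≠ .idle) →
    ∃ q, m ≤ q ∧ q < n ∧ R.act q = .ret i

/-- The first asynchronous cycle of the suffix that starts in state `m` ends in state `n`. -/
def IsCycle (m n : ℕ) : Prop :=
  m ≤ n ∧ R.Covers m n ∧ ∀ n', m ≤ n' → n' < n → ¬ R.Covers m n'

/-- The first `C` asynchronous cycles of the suffix that starts in state `m` end in state `n`. -/
def CyclesEnd (m : ℕ) : ℕ → ℕ → Prop
  | 0, n => n = m
  | C + 1, n => ∃ n', CyclesEnd m C n' ∧ R.IsCycle n' n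

/-- State `n` is reached within `C` asynchronous cycles (which do come to an end) of the suffix that
starts in state `m`. -/
def WithinCycles (m C n : ℕ) : Prop :=
  ∃ n', R.CyclesEnd m C n' ∧ m ≤ n ∧ n ≤ n'

/-! ### Operations -/

/-- The operation `(i, b)`, which the client at `i` runs from state `b` on, is on-going in state `n`.
If `0 < b`, then `c_{b-1}` is its starting system state and the step that follows executes the first
line of its procedure; if `b = 0`, the client is running already in the starting state of the
execution, and the operation is incomplete. -/
def Ongoing (i : Fin N) (b n : ℕ) : Prop :=
  b ≤ n ∧ (∀ p, b ≤ p → p ≤ n → (R.st p).client i ≠ .idle) ∧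
    (b = 0 ∨ (R.st (b - 1)).client i = .idle)

/-- Step `n` belongs to the operation `(i, b)`: it is its invocation or another step of its client,
or a server receives a request of the operation (and replies), or the client receives a reply to
such a request. Client requests of `i` and replies to `i` that are in transit in the starting state
count as part of the incomplete operation `(i, 0)`. -/
inductive OpStep (i : Fin N) (b : ℕ) : ℕ → Prop
  | invocation (n : ℕ) : b = n + 1 → R.Ongoing i b b → OpStep i b n
  | client (n : ℕ) : R.Ongoing i b n →
      ((∃ j, R.act n = .requestSend i j) ∨ R.act n = .localAccess i ∨ R.act n = .ret i) →
      OpStep i b n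
  | initialRequest (n : ℕ) (j : Fin N) (q : Request N Word) : b = 0 → R.ReceivesInitial i j n →
      ((R.st n).chan i j).head? = some (.request q) → OpStep i b n
  | initialReply (n : ℕ) (j : Fin N) (q : Request N Word) (a : Reply N Word) : b = 0 →
      R.ReceivesInitial j i n → ((R.st n).chan j i).head? = some (.ack q a) → OpStep i b n
  | request (s n : ℕ) (j : Fin N) : OpStep i b s → R.act s = .requestSend i j →
      R.ReceivedAt i j s n → OpStep i b n
  | reply (s n : ℕ) (j : Fin N) : OpStep i b s → R.act s = .recv i j →
      R.ReceivedAt j i s n → OpStep i b n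

/-- The suffix that starts in state `m` includes (a part of) the operation `(i, b)`. -/
def SuffixIncludes (m : ℕ) (i : Fin N) (b : ℕ) : Prop :=
  ∃ n, m ≤ n ∧ (R.Ongoing i b n ∨ R.OpStep i b n)

/-- The operation `(i, b)` is a write operation. -/
def IsWriteOp (i : Fin N) (b : ℕ) : Prop :=
  R.Ongoing i b b ∧ ∃ r acks, (R.st b).client i = .busy r acks ∧ r.IsWrite

/-- The operation `(i, b)` starts with the first line and ends with the last line of its
procedure. -/
def Complete (i : Fin N) (b : ℕ) : Prop :=
  b ≠ 0 ∧ ∃ n, R.Ongoing i b n ∧ R.act n = .ret i ∧ (R.st (n + 1)).client i = .idle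

/-- `t` is the tag of the write operation `(i, b)`, which it uses in its pre-write. -/
def WriteTag (i : Fin N) (b : ℕ) (t : Tag N) : Prop :=
  ∃ n s acks, R.Ongoing i b n ∧ (R.st n).client i = .busy (.wPre s t) acks

/-- The write operation `(i, b)` is valid: it is complete, and there is a system state, before its
starting system state `c_{b-1}`, such that its tag exceeds every tag that appears both in that state
and in the starting state of the execution. -/
def ValidWrite (i : Fin N) (b : ℕ) : Prop :=
  R.Complete i b ∧ ∃ t, R.WriteTag i b t ∧
    ∃ p, p + 1 < b ∧ ∀ t' ∈ (R.st 0).tags ∩ (R.st p).tags, t' < t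

end Execution

end Steps

end

end CAS

/-!
Fairness alone makes every message arrive and every call of `qrmAccess` return, so that every
asynchronous cycle comes to an end. A client procedure has at most four rounds, hence an operation
stops running within four cycles; its last requests arrive within one more cycle and the replies to
them within another, since in each cycle the gossip message between two nodes flushes the FIFO
channel. So six cycles free the execution of every operation that started before them.

After three cycles, all tags in gossip variables, gossip messages and acknowledgments are ones
that some server stores, and the tags in requests are stored within a fourth cycle, when the
requests are served. Storages never lose tags, and in a fifth cycle gossip raises the maximal tag
of every server above all these tags. In a sixth cycle, the older replies to queries are flushed.
Hence a writer that starts later only collects tags at least as large as every tag in the state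
after three cycles, and its own tag exceeds them.
-/

namespace CAS

open scoped Classical

/-! ### Tags in the storage of a server -/

section Server

variable {N : ℕ} {Word : Type v}

/-- The tags of the records of a storage, of every phase. -/
def storeTags (S : Finset (Record N Word)) : Set (Tag N) := {t | ∃ s ∈ S, s.tag = t}

theorem UpdatePhase.mem_storeTags {S S' : Finset (Record N Word)} {t : Tag N} {w : Option Word}
    {d : Phase} (h : UpdatePhase S t w d S') {u : Tag N} :
    u ∈ storeTags S' ↔ u ∈ storeTags S ∨ u = t := by
  rcases h with ⟨s, _, rfl, -, -, rfl⟩ | ⟨-, rfl⟩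
  · constructor
    · rintro ⟨x, hx, rfl⟩
      rcases Finset.mem_insert.1 hx with rfl | hx
      · exact .inr rfl
      · exact .inl ⟨x, Finset.mem_of_mem_erase hx, rfl⟩
    · rintro (⟨x, hx, rfl⟩ | rfl)
      · by_cases hxs : x = s
        · exact ⟨_, Finset.mem_insert_self _ _, hxs ▸ rfl⟩
        · exact ⟨x, Finset.mem_insert_of_mem (Finset.mem_erase.2 ⟨hxs, hx⟩), rfl⟩
      · exact ⟨_, Finset.mem_insert_self _ _, rfl⟩
  · constructor
    · rintro ⟨x, hx, rfl⟩
      rcases Finset.mem_insert.1 hx with rfl | hx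
      · exact .inr rfl
      · exact .inl ⟨x, (Finset.mem_filter.1 hx).1, rfl⟩
    · rintro (⟨x, hx, rfl⟩ | rfl)
      · by_cases hxt : x.tag = t
        · exact ⟨_, Finset.mem_insert_self _ _, hxt.symm⟩
        · exact ⟨x, Finset.mem_insert_of_mem (Finset.mem_filter.2 ⟨hx, hxt⟩), rfl⟩
      · exact ⟨_, Finset.mem_insert_self _ _, rfl⟩

theorem exists_updatePhase (S : Finset (Record N Word)) (t : Tag N) (w : Option Word)
    (d : Phase) : ∃ S', UpdatePhase S t w d S' := by
  by_cases h : ∃ s ∈ S, s.tag = t ∧ s.word ≠ none ∧ w = none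
  · obtain ⟨s, hs, ht, hw, hw'⟩ := h
    exact ⟨_, .inl ⟨s, hs, ht, hw, hw', rfl⟩⟩
  · exact ⟨_, .inr ⟨h, rfl⟩⟩

theorem exists_finReply (corrupt : Prop) (S : Finset (Record N Word)) (r : Role) (t : Tag N)
    (d : Phase) : ∃ a, FinReply corrupt S r t d a := by
  cases r with
  | writer => exact ⟨⟨t, none⟩, rfl, rfl⟩
  | reader =>
    by_cases h : ∃ s ∈ S, s.tag = t ∧ s.phase = d
    · obtain ⟨s, hs, ht, hd⟩ := h
      exact ⟨⟨t, s.word⟩, rfl, .inr (.inl ⟨s, hs, ht, hd, rfl⟩)⟩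
    · exact ⟨⟨t, none⟩, rfl, .inr (.inr ⟨h, rfl⟩)⟩

variable [NeZero N]

theorem maxPhase_eq_bot_or_mem (S : Finset (Record N Word)) (D : Set Phase) :
    maxPhase S D = ⊥ ∨ maxPhase S D ∈ storeTags S := by
  rcases (S.filter fun s => s.phase ∈ D).eq_empty_or_nonempty with hempty | hne
  · left
    rw [maxPhase, hempty, Finset.sup_empty]
  · right
    obtain ⟨s, hs, hmax⟩ := Finset.exists_mem_eq_sup _ hne Record.tag
    exact ⟨s, (Finset.mem_filter.1 hs).1, hmax.symm⟩

theorem le_maxPhase_univ {S : Finset (Record N Word)} {t : Tag N} (h : t ∈ storeTags S) :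
    t ≤ maxPhase S Set.univ := by
  obtain ⟨s, hs, rfl⟩ := h
  exact Finset.le_sup (f := Record.tag) (by simpa using hs)

theorem maxPhase_univ_mono {S S' : Finset (Record N Word)} (h : storeTags S ⊆ storeTags S') :
    maxPhase S Set.univ ≤ maxPhase S' Set.univ := by
  rcases maxPhase_eq_bot_or_mem S Set.univ with hbot | hmem
  · exact hbot ▸ bot_le
  · exact le_maxPhase_univ (h hmem)

theorem tagTuple_tags_subset (S : Finset (Record N Word)) :
    (tagTuple S).tags ⊆ insert ⊥ (storeTags S) := by
  rintro t (rfl | rfl | rfl) <;> exact maxPhase_eq_bot_or_mem _ _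

theorem exists_serve (corrupt : Prop) (S : Finset (Record N Word)) (q : Request N Word) :
    ∃ S' a, Serve corrupt S q S' a := by
  cases q with
  | qry r => cases r <;> exact ⟨_, _, rfl, rfl⟩
  | pre t w =>
    obtain ⟨S', hS⟩ := exists_updatePhase S t w .pre
    exact ⟨S', _, hS, rfl⟩
  | fin r t =>
    obtain ⟨S', hS⟩ := exists_updatePhase S t none .fin
    obtain ⟨a, ha⟩ := exists_finReply corrupt S' r t .fin
    exact ⟨S', a, hS, ha⟩
  | FIN r t =>
    obtain ⟨S', hS⟩ := exists_updatePhase S t none .FIN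
    obtain ⟨a, ha⟩ := exists_finReply corrupt S' r t .FIN
    exact ⟨S', a, hS, ha⟩

namespace Serve

variable {corrupt : Prop} {S S' : Finset (Record N Word)} {q : Request N Word} {a : Reply N Word}

theorem mem_storeTags (h : Serve corrupt S q S' a) {u : Tag N} :
    u ∈ storeTags S' ↔ u ∈ storeTags S ∨ u ∈ q.tags := by
  cases q with
  | qry r => cases r <;> simp [h.1, Request.tags]
  | pre t w => exact h.1.mem_storeTags
  | fin r t => exact h.1.mem_storeTags
  | FIN r t => exact h.1.mem_storeTags

theorem reply_tag_mem (h : Serve corrupt S q S' a) : a.tag ∈ insert ⊥ (storeTags S') := by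
  cases q with
  | qry r => cases r <;> (obtain ⟨rfl, rfl⟩ := h; exact maxPhase_eq_bot_or_mem _ _)
  | pre t w =>
    obtain ⟨hS, rfl⟩ := h
    exact .inr (hS.mem_storeTags.2 (.inr rfl))
  | fin r t => exact .inr (h.1.mem_storeTags.2 (.inr h.2.1))
  | FIN r t => exact .inr (h.1.mem_storeTags.2 (.inr h.2.1))

end Serve

theorem exists_gossipUpdate (k e : ℕ) (i : Fin N) (g : Fin N → Triple N)
    (S : Finset (Record N Word)) : ∃ S' m, GossipUpdate k e i g S S' m := by
  let pre := (Finset.univ.sup fun l => (g l).pre ⊔ (g l).fin ⊔ (g l).FIN) ⊔ maxPhase S Set.univ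
  obtain ⟨S₁, h₁⟩ := exists_updatePhase S pre none .pre
  let fin := (Finset.univ.sup fun l => (g l).fin ⊔ (g l).FIN) ⊔
    maxPhase S₁ {Phase.fin, Phase.FIN}
  obtain ⟨S₂, h₂⟩ := exists_updatePhase S₁ fin none .fin
  let known := Function.update g i ⟨pre, fin, (g i).FIN⟩
  let FIN := (Finset.univ.sup fun l => (g l).FIN) ⊔ maxPhase S₂ {Phase.FIN} ⊔
    (Finset.univ.filter fun l => IsQuorum k e (Finset.univ.filter fun l' =>
      (known l').fin = (known l).fin)).sup fun l => (known l).fin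
  obtain ⟨S₃, h₃⟩ := exists_updatePhase S₂ FIN none .FIN
  exact ⟨S₃, ⟨pre, fin, FIN⟩, S₁, S₂, rfl, h₁, rfl, h₂, rfl, h₃⟩

namespace GossipUpdate

variable {k e : ℕ} {i : Fin N} {g : Fin N → Triple N} {S S' : Finset (Record N Word)}
  {m : Triple N}

theorem mem_storeTags (h : GossipUpdate k e i g S S' m) {u : Tag N} :
    u ∈ storeTags S' ↔ u ∈ storeTags S ∨ u ∈ m.tags := by
  obtain ⟨S₁, S₂, -, h₁, -, h₂, -, h₃⟩ := h
  rw [h₃.mem_storeTags, h₂.mem_storeTags, h₁.mem_storeTags, or_assoc, or_assoc]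
  rfl

theorem le_pre (h : GossipUpdate k e i g S S' m) (l : Fin N) : (g l).pre ≤ m.pre := by
  obtain ⟨S₁, S₂, hpre, -⟩ := h
  rw [hpre]
  exact le_sup_of_le_left ((le_sup_left.trans le_sup_left).trans
    (Finset.le_sup (f := fun l => (g l).pre ⊔ (g l).fin ⊔ (g l).FIN) (Finset.mem_univ l)))

end GossipUpdate

end Server

section Client

variable {N : ℕ} {Sec : Type u} {Word : Type v}

/-- The acknowledgments that a node has collected in the current round of its client. -/
def Client.acks : Client N Sec Word → Fin N → Option (Reply N Word)
  | .idle => fun _ => none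
  | .busy _ acks => acks

/-- The number of rounds that a client has still to complete. -/
def Client.rank : Client N Sec Word → ℕ
  | .idle => 0
  | .busy (.wQry _) _ => 4
  | .busy (.wPre _ _) _ => 3
  | .busy (.wFin _) _ => 2
  | .busy (.wFIN _) _ => 1
  | .busy .rQry _ => 2
  | .busy (.rFin _) _ => 1

theorem Client.rank_le (c : Client N Sec Word) : c.rank ≤ 4 := by
  rcases c with _ | ⟨_ | _ | _ | _ | _ | _, _⟩ <;> simp [Client.rank]

theorem Client.rank_eq_zero_iff {c : Client N Sec Word} : c.rank = 0 ↔ c = .idle := by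
  rcases c with _ | ⟨_ | _ | _ | _ | _ | _, _⟩ <;> simp [Client.rank]

theorem Client.rank_busy_eq (r : Round N Sec) (acks acks' : Fin N → Option (Reply N Word)) :
    (Client.busy r acks).rank = (Client.busy r acks').rank := by
  cases r <;> rfl

theorem Round.request_tags {k e : ℕ} (P : Setup N k e Sec Word) (j : Fin N) (r : Round N Sec) :
    (r.request P j).tags = r.tags := by
  cases r <;> rfl

variable [NeZero N]

theorem rank_nextClient (i : Fin N) (r : Round N Sec) (acks : Fin N → Option (Reply N Word)) :
    (nextClient i r acks).rank + 1 = (Client.busy r acks).rank := by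
  cases r <;> rfl

theorem acks_nextClient (i : Fin N) (r : Round N Sec) (acks : Fin N → Option (Reply N Word)) :
    (nextClient i r acks).acks = fun _ => none := by
  cases r <;> rfl

theorem le_maxAck {acks : Fin N → Option (Reply N Word)} {j : Fin N} {a : Reply N Word}
    (h : acks j = some a) : a.tag ≤ maxAck acks := by
  have hle : ((acks j).map Reply.tag).getD ⊥ ≤ maxAck acks :=
    Finset.le_sup (f := fun j => ((acks j).map Reply.tag).getD ⊥) (Finset.mem_univ j)
  simpa only [h, Option.map_some, Option.getD_some] using hle

theorem IsQuorum.nonempty {k e : ℕ} {A : Finset (Fin N)} (h : IsQuorum k e A) : A.Nonempty := by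
  have hN := NeZero.pos N
  rw [IsQuorum] at h
  exact Finset.card_pos.1 (by omega)

end Client

/-! ### The effect of a step on the components of the state -/

section Steps

theorem setChan_apply {N : ℕ} {α : Type v} (ch : Fin N → Fin N → α) (i j : Fin N) (l : α)
    (i' j' : Fin N) :
    setChan ch i j l i' j' = if i' = i ∧ j' = j then l else ch i' j' := by
  by_cases hi : i' = i
  · subst hi
    simp [setChan, Function.update_apply]
  · simp [setChan, hi]

variable {N k e : ℕ} [NeZero N] {Sec : Type u} {Word : Type v} {P : Setup N k e Sec Word}

/-- The messages that the node `i` may send to `j` in a step from `c` to `c'`: the gossip message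
and the request that it holds in `c`, and acknowledgments of requests that its server handles in
this step. -/
inductive Sends (P : Setup N k e Sec Word) (i j : Fin N) (c c' : State N Sec Word) :
    Msg N Word → Prop
  | gossip : Sends P i j c c' (.gossip (c.gossipTx i))
  | request (r : Round N Sec) (acks : Fin N → Option (Reply N Word)) :
      c.client i = .busy r acks → Sends P i j c c' (.request (r.request P j))
  | ack (q : Request N Word) (a : Reply N Word) :
      Serve (i ∈ P.corrupt) (c.store i) q (c'.store i) a → Sends P i j c c' (.ack q a)

/-- The step `x` from `c` to `c'` as it affects the client at `i`. An acknowledgment is collected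
from the channel of its sender, or from the server of the client's own node. -/
inductive ClientStep (P : Setup N k e Sec Word) (i : Fin N) (x : Action N Sec)
    (c c' : State N Sec Word) : Prop
  | unchanged : x ≠ .ret i → c'.client i = c.client i → ClientStep P i x c c'
  | invokeWrite (s : Sec) : c.client i = .idle →
      c'.client i = .busy (.wQry s) (fun _ => none) → ClientStep P i x c c'
  | invokeRead : c.client i = .idle → c'.client i = .busy .rQry (fun _ => none) →
      ClientStep P i x c c'
  | collect (r : Round N Sec) (acks : Fin N → Option (Reply N Word)) (j : Fin N)
      (a : Reply N Word) : x ≠ .ret i → c.client i = .busy r acks →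
      c'.client i = .busy r (Function.update acks j (some a)) →
      (j ≠ i ∧ .ack (r.request P j) a ∈ c.chan j i ∨
        Serve (j ∈ P.corrupt) (c.store j) (r.request P j) (c'.store j) a) →
      ClientStep P i x c c'
  | ret (r : Round N Sec) (acks : Fin N → Option (Reply N Word)) : x = .ret i →
      c.client i = .busy r acks → IsQuorum k e (Finset.univ.filter fun j => acks j ≠ none) →
      c'.client i = nextClient i r acks → ClientStep P i x c c'

theorem ClientStep.rank_le {c c' : State N Sec Word} {x : Action N Sec} {i : Fin N}
    (h : ClientStep P i x c c') (hc : c.client i ≠ .idle) :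
    (c'.client i).rank ≤ (c.client i).rank := by
  rcases h with ⟨-, heq⟩ | ⟨_, hidle, -⟩ | ⟨hidle, -⟩ | ⟨r, acks, j, a, -, hbusy, hbusy', -⟩ |
    ⟨r, acks, -, hbusy, -, hnext⟩
  · rw [heq]
  · exact absurd hidle hc
  · exact absurd hidle hc
  · rw [hbusy, hbusy', Client.rank_busy_eq]
  · rw [hbusy, hnext, ← rank_nextClient i]
    exact Nat.le_succ _

namespace Step

variable {c c' : State N Sec Word} {x : Action N Sec} {i j : Fin N}

theorem ne_of_recv (h : Step P c (.recv i j) c') : i ≠ j := h.1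

theorem receive (h : Step P c (.recv i j) c') {m : Msg N Word}
    (hm : (c.chan i j).head? = some m) : ∃ l, Receive P c i j m l c' := by
  obtain ⟨-, m', l, hc, hrec⟩ := h
  rw [hc, List.head?_cons, Option.some.injEq] at hm
  exact ⟨l, hm ▸ hrec⟩

theorem chan_of_recv (h : Step P c (.recv i j) c') : ∃ m, c.chan i j = m :: c'.chan i j := by
  obtain ⟨hij, m, l, hc, hrec⟩ := h
  refine ⟨m, hc.trans ?_⟩
  cases m with
  | gossip g =>
    obtain ⟨S', m', -, rfl⟩ := hrec
    simp [setChan_apply]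
  | request q =>
    obtain ⟨S', a, -, rfl⟩ := hrec
    simp [setChan_apply, hij]
  | ack q a =>
    obtain rfl := hrec
    simp [setChan_apply]

theorem chan_of_recv_ne {i' j' : Fin N} (h : Step P c (.recv i' j') c')
    (hne : ¬ (i = i' ∧ j = j')) :
    ∃ l, c'.chan i j = c.chan i j ++ l ∧ ∀ m ∈ l, Sends P i j c c' m := by
  obtain ⟨-, m, l, -, hrec⟩ := h
  cases m with
  | gossip g =>
    obtain ⟨S', m', -, rfl⟩ := hrec
    exact ⟨[], by simp [setChan_apply, hne], by simp⟩
  | request q =>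
    obtain ⟨S', a, hserve, rfl⟩ := hrec
    by_cases hreply : i = j' ∧ j = i'
    · obtain ⟨rfl, rfl⟩ := hreply
      exact ⟨[.ack q a], by simp [setChan_apply], by simpa using .ack q a (by simpa using hserve)⟩
    · exact ⟨[], by simp [setChan_apply, hne, hreply], by simp⟩
  | ack q a =>
    obtain rfl := hrec
    exact ⟨[], by simp [setChan_apply, hne], by simp⟩

theorem chan_of_ne_recv (h : Step P c x c') (hx : x ≠ .recv i j) :
    ∃ l, c'.chan i j = c.chan i j ++ l ∧ ∀ m ∈ l, Sends P i j c c' m := by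
  have unchanged (hc : c'.chan i j = c.chan i j) :
      ∃ l, c'.chan i j = c.chan i j ++ l ∧ ∀ m ∈ l, Sends P i j c c' m :=
    ⟨[], by simp [hc], by simp⟩
  have send {m : Msg N Word} (hc : c'.chan i j = c.chan i j ++ [m]) (hm : Sends P i j c c' m) :
      ∃ l, c'.chan i j = c.chan i j ++ l ∧ ∀ m ∈ l, Sends P i j c c' m :=
    ⟨[m], hc, by simpa using hm⟩
  cases x with
  | invokeWrite i' s => obtain ⟨-, rfl⟩ := h; exact unchanged rfl
  | invokeRead i' => obtain ⟨-, rfl⟩ := h; exact unchanged rfl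
  | requestSend i' j' =>
    obtain ⟨-, r, acks, hc, rfl⟩ := h
    by_cases hij : i = i' ∧ j = j'
    · obtain ⟨rfl, rfl⟩ := hij
      exact send (by simp [setChan_apply]) (.request r acks hc)
    · exact unchanged (by simp [setChan_apply, hij])
  | localAccess i' => obtain ⟨r, acks, -, S', a, -, rfl⟩ := h; exact unchanged rfl
  | ret i' => obtain ⟨r, acks, -, -, rfl⟩ := h; exact unchanged rfl
  | gossipSend i' j' =>
    obtain ⟨-, rfl⟩ := h
    by_cases hij : i = i' ∧ j = j'
    · obtain ⟨rfl, rfl⟩ := hij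
      exact send (by simp [setChan_apply]) .gossip
    · exact unchanged (by simp [setChan_apply, hij])
  | recv i' j' => exact h.chan_of_recv_ne fun hij => hx (hij.1 ▸ hij.2 ▸ rfl)

theorem exists_recv (hij : i ≠ j) (hc : c.chan i j ≠ []) : ∃ c', Step P c (.recv i j) c' := by
  obtain ⟨m, l, hml⟩ := List.exists_cons_of_ne_nil hc
  cases m with
  | gossip g =>
    obtain ⟨S', m', hg⟩ :=
      exists_gossipUpdate k e j (Function.update (c.gossip j) i g) (c.store j)
    exact ⟨_, hij, _, l, hml, S', m', hg, rfl⟩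
  | request q =>
    obtain ⟨S', a, hserve⟩ := exists_serve (j ∈ P.corrupt) (c.store j) q
    exact ⟨_, hij, _, l, hml, S', a, hserve, rfl⟩
  | ack q a => exact ⟨_, hij, _, l, hml, rfl⟩

theorem recv_gossip (h : Step P c (.recv i j) c') {g : Triple N}
    (hg : (c.chan i j).head? = some (.gossip g)) :
    ∃ m, GossipUpdate k e j (Function.update (c.gossip j) i g) (c.store j) (c'.store j) m ∧
      c'.gossip j = Function.update (Function.update (c.gossip j) i g) j m ∧
      c'.gossipTx j = tagTuple (c'.store j) := by
  obtain ⟨l, S', m, hupdate, rfl⟩ := h.receive hg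
  exact ⟨m, by simpa using hupdate, by simp, by simp⟩

theorem recv_request (h : Step P c (.recv i j) c') {q : Request N Word}
    (hq : (c.chan i j).head? = some (.request q)) :
    ∃ a, c'.chan j i = c.chan j i ++ [.ack q a] ∧
      Serve (j ∈ P.corrupt) (c.store j) q (c'.store j) a := by
  obtain ⟨l, S', a, hserve, rfl⟩ := h.receive hq
  exact ⟨a, by simp [setChan_apply], by simpa using hserve⟩

theorem recv_ack (h : Step P c (.recv j i) c') {r : Round N Sec}
    {acks : Fin N → Option (Reply N Word)} {a : Reply N Word}
    (ha : (c.chan j i).head? = some (.ack (r.request P j) a)) (hc : c.client i = .busy r acks) :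
    c'.client i = .busy r (Function.update acks j (some a)) := by
  obtain ⟨l, rfl⟩ := h.receive ha
  simp [hc, collect]

theorem storeTags_subset_of_recv (h : Step P c (.recv i j) c') :
    storeTags (c.store j) ⊆ storeTags (c'.store j) := by
  obtain ⟨-, m, l, -, hrec⟩ := h
  cases m with
  | gossip g =>
    obtain ⟨S', m', hupdate, rfl⟩ := hrec
    intro t ht
    simpa using hupdate.mem_storeTags.2 (.inl ht)
  | request q =>
    obtain ⟨S', a, hserve, rfl⟩ := hrec
    intro t ht
    simpa using hserve.mem_storeTags.2 (.inl ht)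
  | ack q a => obtain rfl := hrec; exact subset_rfl

theorem store_of_recv_ne {j' : Fin N} (h : Step P c (.recv i j') c') (hne : j ≠ j') :
    c'.store j = c.store j := by
  obtain ⟨-, m, l, -, hrec⟩ := h
  cases m with
  | gossip g => obtain ⟨S', m', -, rfl⟩ := hrec; simp [hne]
  | request q => obtain ⟨S', a, -, rfl⟩ := hrec; simp [hne]
  | ack q a => obtain rfl := hrec; rfl

theorem storeTags_subset (h : Step P c x c') (j : Fin N) :
    storeTags (c.store j) ⊆ storeTags (c'.store j) := by
  cases x with
  | invokeWrite i s => obtain ⟨-, rfl⟩ := h; exact subset_rfl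
  | invokeRead i => obtain ⟨-, rfl⟩ := h; exact subset_rfl
  | requestSend i i' => obtain ⟨-, r, acks, -, rfl⟩ := h; exact subset_rfl
  | localAccess i =>
    obtain ⟨r, acks, -, S', a, hserve, rfl⟩ := h
    by_cases hj : j = i
    · subst hj
      intro t ht
      simpa using hserve.mem_storeTags.2 (.inl ht)
    · simp [hj]
  | ret i => obtain ⟨r, acks, -, -, rfl⟩ := h; exact subset_rfl
  | gossipSend i i' => obtain ⟨-, rfl⟩ := h; exact subset_rfl
  | recv i i' =>
    by_cases hj : j = i'
    · exact hj ▸ h.storeTags_subset_of_recv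
    · rw [h.store_of_recv_ne hj]

theorem gossip_eq_or_recv_gossip (h : Step P c x c') (j : Fin N) :
    (c'.gossip j = c.gossip j ∧ c'.gossipTx j = c.gossipTx j) ∨
      ∃ i g, x = .recv i j ∧ (c.chan i j).head? = some (.gossip g) := by
  cases x with
  | invokeWrite i s => obtain ⟨-, rfl⟩ := h; exact .inl ⟨rfl, rfl⟩
  | invokeRead i => obtain ⟨-, rfl⟩ := h; exact .inl ⟨rfl, rfl⟩
  | requestSend i i' => obtain ⟨-, r, acks, -, rfl⟩ := h; exact .inl ⟨rfl, rfl⟩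
  | localAccess i => obtain ⟨r, acks, -, S', a, -, rfl⟩ := h; exact .inl ⟨rfl, rfl⟩
  | ret i => obtain ⟨r, acks, -, -, rfl⟩ := h; exact .inl ⟨rfl, rfl⟩
  | gossipSend i i' => obtain ⟨-, rfl⟩ := h; exact .inl ⟨rfl, rfl⟩
  | recv i i' =>
    obtain ⟨-, m, l, hm, hrec⟩ := h
    cases m with
    | gossip g =>
      by_cases hj : j = i'
      · exact .inr ⟨i, g, hj ▸ rfl, by simp [hj, hm]⟩
      · obtain ⟨S', m', -, rfl⟩ := hrec
        simp [hj]
    | request q => obtain ⟨S', a, -, rfl⟩ := hrec; exact .inl ⟨rfl, rfl⟩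
    | ack q a => obtain rfl := hrec; exact .inl ⟨rfl, rfl⟩

theorem clientStep_of_recv (h : Step P c (.recv j i) c') (i' : Fin N) :
    ClientStep P i' (.recv j i) c c' := by
  obtain ⟨hji, m, l, hm, hrec⟩ := h
  cases m with
  | gossip g => obtain ⟨S', m', -, rfl⟩ := hrec; exact .unchanged (by simp) rfl
  | request q => obtain ⟨S', a, -, rfl⟩ := hrec; exact .unchanged (by simp) rfl
  | ack q a =>
    obtain rfl := hrec
    by_cases hi : i' = i
    · subst hi
      cases hc : c.client i' with
      | idle => exact .unchanged (by simp) (by simp [hc, collect])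
      | busy r acks =>
        by_cases hq : r.request P j = q
        · exact .collect r acks j a (by simp) hc (by simp [collect, hq])
            (.inl ⟨hji, by simp [hm, hq]⟩)
        · exact .unchanged (by simp) (by simp [collect, hq, hc])
    · exact .unchanged (by simp) (by simp [hi])

theorem clientStep (h : Step P c x c') (i : Fin N) : ClientStep P i x c c' := by
  cases x with
  | invokeWrite i' s =>
    obtain ⟨hc, rfl⟩ := h
    by_cases hi : i = i'
    · exact .invokeWrite s (hi ▸ hc) (by simp [hi])
    · exact .unchanged (by simp) (by simp [hi])
  | invokeRead i' =>
    obtain ⟨hc, rfl⟩ := h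
    by_cases hi : i = i'
    · exact .invokeRead (hi ▸ hc) (by simp [hi])
    · exact .unchanged (by simp) (by simp [hi])
  | requestSend i' j => obtain ⟨-, r, acks, -, rfl⟩ := h; exact .unchanged (by simp) rfl
  | localAccess i' =>
    obtain ⟨r, acks, hc, S', a, hserve, rfl⟩ := h
    by_cases hi : i = i'
    · subst hi
      exact .collect r acks i a (by simp) hc (by simp) (.inr (by simpa using hserve))
    · exact .unchanged (by simp) (by simp [hi])
  | ret i' =>
    obtain ⟨r, acks, hc, hquorum, rfl⟩ := h
    by_cases hi : i = i'
    · subst hi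
      exact .ret r acks rfl hc hquorum (by simp)
    · exact .unchanged (by simpa using Ne.symm hi) (by simp [hi])
  | gossipSend i' j => obtain ⟨-, rfl⟩ := h; exact .unchanged (by simp) rfl
  | recv j i' => exact h.clientStep_of_recv i

end Step

end Steps

namespace Execution

variable {N k e : ℕ} [NeZero N] {Sec : Type u} {Word : Type v} {P : Setup N k e Sec Word}
  (R : Execution P)

/-! ### Channels as FIFO queues -/

/-- The number of messages that have left the channel from `i` to `j` before state `n`. -/
noncomputable def received (i j : Fin N) (n : ℕ) : ℕ := Nat.count (fun p => R.act p = .recv i j) n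

/-- The messages that have left the channel from `i` to `j` before state `n`, oldest first. -/
noncomputable def delivered (i j : Fin N) : ℕ → List (Msg N Word)
  | 0 => []
  | n + 1 =>
    if R.act n = .recv i j then delivered i j n ++ ((R.st n).chan i j).take 1
    else delivered i j n

/-- The messages that have entered the channel from `i` to `j` before state `n`, oldest first and
including those of the starting state. A later state only appends to this list, so that the
positions in it serve as permanent names of messages. -/
noncomputable def sent (i j : Fin N) (n : ℕ) : List (Msg N Word) :=
  R.delivered i j n ++ (R.st n).chan i j

variable {R} {i j : Fin N} {m n : ℕ}

theorem received_succ_of_eq (h : R.act n = .recv i j) :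
    R.received i j (n + 1) = R.received i j n + 1 := by
  simp [received, Nat.count_succ, h]

theorem received_succ_of_ne (h : R.act n ≠ .recv i j) :
    R.received i j (n + 1) = R.received i j n := by
  simp [received, Nat.count_succ, h]

theorem received_mono (h : m ≤ n) : R.received i j m ≤ R.received i j n :=
  Nat.count_monotone _ h

theorem exists_chan_eq_cons (h : R.act n = .recv i j) :
    ∃ x, (R.st n).chan i j = x :: (R.st (n + 1)).chan i j :=
  (h ▸ R.step n : Step P _ (.recv i j) _).chan_of_recv

theorem length_delivered : (R.delivered i j n).length = R.received i j n := by
  induction n with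
  | zero => simp [delivered, received]
  | succ n ih =>
    by_cases h : R.act n = .recv i j
    · obtain ⟨x, hx⟩ := exists_chan_eq_cons h
      simp [delivered, received_succ_of_eq, h, hx, ih]
    · simp [delivered, received_succ_of_ne, h, ih]

theorem exists_sent_eq_append (hmn : m ≤ n) : ∃ l, R.sent i j n = R.sent i j m ++ l ∧
    ∀ x ∈ l, ∃ s, m ≤ s ∧ s < n ∧ Sends P i j (R.st s) (R.st (s + 1)) x := by
  induction n, hmn using Nat.le_induction with
  | base => exact ⟨[], by simp, by simp⟩
  | succ n hmn ih =>
    obtain ⟨l, hsent, hl⟩ := ih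
    have hl' : ∀ x ∈ l, ∃ s, m ≤ s ∧ s < n + 1 ∧ Sends P i j (R.st s) (R.st (s + 1)) x := by
      intro x hx
      obtain ⟨s, hms, hsn, hs⟩ := hl x hx
      exact ⟨s, hms, hsn.trans n.lt_succ_self, hs⟩
    by_cases h : R.act n = .recv i j
    · obtain ⟨x, hx⟩ := exists_chan_eq_cons h
      refine ⟨l, ?_, hl'⟩
      rw [← hsent]
      simp [sent, delivered, h, hx]
    · obtain ⟨new, hchan, hnew⟩ := (R.step n).chan_of_ne_recv h
      refine ⟨l ++ new, ?_, ?_⟩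
      · rw [← List.append_assoc, ← hsent]
        simp [sent, delivered, h, hchan]
      · intro x hx
        rcases List.mem_append.1 hx with hx | hx
        · exact hl' x hx
        · exact ⟨n, hmn, n.lt_succ_self, hnew x hx⟩

theorem length_sent_mono (hmn : m ≤ n) : (R.sent i j m).length ≤ (R.sent i j n).length := by
  obtain ⟨l, hl, -⟩ := exists_sent_eq_append (R := R) (i := i) (j := j) hmn
  simp [hl]

theorem length_sent :
    (R.sent i j n).length = R.received i j n + ((R.st n).chan i j).length := by
  rw [sent, List.length_append, length_delivered]

theorem chan_eq_drop : (R.st n).chan i j = (R.sent i j n).drop (R.received i j n) := by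
  rw [sent, ← length_delivered, List.drop_left]

theorem head?_chan : ((R.st n).chan i j).head? = (R.sent i j n)[R.received i j n]? := by
  rw [chan_eq_drop, List.head?_drop]

theorem getElem?_sent_of_le (hmn : m ≤ n) {p : ℕ} {x : Msg N Word}
    (hx : (R.sent i j m)[p]? = some x) : (R.sent i j n)[p]? = some x := by
  obtain ⟨l, hl, -⟩ := exists_sent_eq_append (R := R) (i := i) (j := j) hmn
  rw [hl, List.getElem?_append_left (List.getElem?_eq_some_iff.1 hx).1, hx]

theorem card_recv_Ioo {s d : ℕ} (h : s < d) : R.received i j (s + 1) +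
    ((Finset.Ioo s d).filter fun p => R.act p = .recv i j).card = R.received i j d := by
  rw [received, received, Nat.count_eq_card_filter_range, Nat.count_eq_card_filter_range,
    ← Finset.card_union_of_disjoint, ← Finset.filter_union]
  · congr 2
    ext p
    simp only [Finset.mem_union, Finset.mem_range, Finset.mem_Ioo]
    omega
  · refine Finset.disjoint_filter_filter (Finset.disjoint_left.2 fun p hp hp' => ?_)
    simp only [Finset.mem_range, Finset.mem_Ioo] at hp hp'
    omega

theorem receivedAt_iff {s d : ℕ} : R.ReceivedAt i j s d ↔
    s < d ∧ R.act d = .recv i j ∧ R.received i j d + 1 = (R.sent i j (s + 1)).length := by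
  refine and_congr_right fun h => and_congr_right fun _ => ?_
  rw [← card_recv_Ioo h, length_sent]
  omega

theorem receivesInitial_iff {d : ℕ} : R.ReceivesInitial i j d ↔
    R.act d = .recv i j ∧ R.received i j d < (R.sent i j 0).length := by
  rw [ReceivesInitial, received, Nat.count_eq_card_filter_range]
  rfl

theorem head?_of_receivedAt {s d : ℕ} (h : R.ReceivedAt i j s d)
    {l : List (Msg N Word)} {x : Msg N Word} (hc : (R.st (s + 1)).chan i j = l ++ [x]) :
    ((R.st d).chan i j).head? = some x := by
  obtain ⟨hsd, -, hr⟩ := receivedAt_iff.1 h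
  rw [head?_chan]
  refine getElem?_sent_of_le hsd ?_
  have hlast : R.received i j d = (R.delivered i j (s + 1) ++ l).length := by
    rw [sent, hc, ← List.append_assoc, List.length_append] at hr
    simpa using hr
  rw [sent, hc, ← List.append_assoc, hlast]
  simp only [List.getElem?_concat_length]

theorem exists_recv_of_received {w : ℕ} (hm : R.received i j m ≤ w)
    (hn : w < R.received i j n) :
    ∃ d, m ≤ d ∧ d < n ∧ R.act d = .recv i j ∧ R.received i j d = w := by
  have hfinite (hf : (Set.ofPred fun p => R.act p = .recv i j).Finite) : w < hf.toFinset.card :=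
    hn.trans_le (Nat.count_le_card hf n)
  have hcount := Nat.count_nth hfinite
  refine ⟨Nat.nth (fun p => R.act p = .recv i j) w, ?_, Nat.nth_lt_of_lt_count hn,
    Nat.nth_mem w hfinite, hcount⟩
  by_contra! hlt
  have hlt' := received_mono (R := R) (i := i) (j := j) hlt
  rw [received_succ_of_eq (Nat.nth_mem w hfinite), received, hcount] at hlt'
  omega

theorem exists_recv_of_mem_chan {x : Msg N Word} (hx : x ∈ (R.st m).chan i j)
    (hn : (R.sent i j m).length ≤ R.received i j n) :
    ∃ d, m ≤ d ∧ d < n ∧ R.act d = .recv i j ∧ ((R.st d).chan i j).head? = some x := by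
  obtain ⟨p, hp⟩ := List.mem_iff_getElem?.1 hx
  rw [chan_eq_drop, List.getElem?_drop] at hp
  have hlt := (List.getElem?_eq_some_iff.1 hp).1
  obtain ⟨d, hmd, hdn, hd, hr⟩ :=
    exists_recv_of_received (Nat.le_add_right _ p) (hlt.trans_le hn)
  exact ⟨d, hmd, hdn, hd, by rw [head?_chan, hr, getElem?_sent_of_le hmd hp]⟩

theorem exists_sends_of_mem_chan (hmn : m ≤ n) (h : (R.sent i j m).length ≤ R.received i j n)
    {x : Msg N Word} (hx : x ∈ (R.st n).chan i j) :
    ∃ s, m ≤ s ∧ s < n ∧ Sends P i j (R.st s) (R.st (s + 1)) x := by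
  obtain ⟨l, hsent, hl⟩ := exists_sent_eq_append (R := R) (i := i) (j := j) hmn
  refine hl x ?_
  rw [chan_eq_drop, hsent, List.drop_append, List.drop_eq_nil_of_le h, List.nil_append] at hx
  exact List.mem_of_mem_drop hx

/-! ### Every cycle comes to an end -/

theorem chan_of_gossipSend (h : R.act n = .gossipSend i j) :
    (R.st (n + 1)).chan i j = (R.st n).chan i j ++ [.gossip ((R.st n).gossipTx i)] := by
  obtain ⟨-, hstep⟩ : Step P _ (.gossipSend i j) _ := h ▸ R.step n
  simp [hstep, setChan_apply]

theorem deliversGossip_of_receivedAt {s d : ℕ} (hs : R.act s = .gossipSend i j)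
    (hd : R.ReceivedAt i j s d) : R.DeliversGossip i j ((R.st s).gossipTx i) d :=
  ⟨hd.2.1, head?_of_receivedAt hd (chan_of_gossipSend hs)⟩

namespace Fair

theorem exists_act (hF : R.Fair) {x : Action N Sec} (hx : ¬ x.IsInvocation)
    (h : ∀ n, m ≤ n → ∃ c', Step P (R.st n) x c') : ∃ n, m ≤ n ∧ R.act n = x :=
  hF x hx (fun p => ⟨max m p, le_max_right _ _, h _ (le_max_left _ _)⟩) m

theorem exists_gossipSend (hF : R.Fair) (hij : i ≠ j) (m : ℕ) :
    ∃ n, m ≤ n ∧ R.act n = .gossipSend i j :=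
  hF.exists_act id fun _ _ => ⟨_, hij, rfl⟩

theorem exists_recv (hF : R.Fair) (hij : i ≠ j) (m : ℕ) : ∃ n, m ≤ n ∧ R.act n = .recv i j := by
  refine hF _ id (fun p => ?_) m
  obtain ⟨s, hps, hs⟩ := hF.exists_gossipSend hij p
  exact ⟨s + 1, hps.trans s.le_succ, Step.exists_recv hij (by simp [chan_of_gossipSend hs])⟩

theorem exists_lt_received (hF : R.Fair) (hij : i ≠ j) (w : ℕ) : ∃ n, w < R.received i j n := by
  have hinfinite : {p | R.act p = .recv i j}.Infinite :=
    Nat.frequently_atTop_iff_infinite.1 (Filter.frequently_atTop.2 (hF.exists_recv hij))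
  exact ⟨_, (Nat.lt_succ_self w).trans_eq (Nat.count_nth_of_infinite hinfinite (w + 1)).symm⟩

theorem exists_receivedAt (hF : R.Fair) (hij : i ≠ j) {s : ℕ}
    (hc : (R.st (s + 1)).chan i j ≠ []) : ∃ d, R.ReceivedAt i j s d := by
  have hlen := List.length_pos_of_ne_nil hc
  obtain ⟨n, hn⟩ := hF.exists_lt_received hij ((R.sent i j (s + 1)).length - 1)
  rw [length_sent] at hn
  obtain ⟨d, hsd, -, hd, hr⟩ := exists_recv_of_received (m := s + 1) (by omega) hn
  exact ⟨d, receivedAt_iff.2 ⟨hsd, hd, by rw [hr, length_sent]; omega⟩⟩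

theorem exists_receivedAt_of_gossipSend (hF : R.Fair) (hij : i ≠ j) (m : ℕ) :
    ∃ s d, m ≤ s ∧ R.act s = .gossipSend i j ∧ R.ReceivedAt i j s d := by
  obtain ⟨s, hms, hs⟩ := hF.exists_gossipSend hij m
  obtain ⟨d, hd⟩ := hF.exists_receivedAt hij (s := s) (by simp [chan_of_gossipSend hs])
  exact ⟨s, d, hms, hs, hd⟩

theorem exists_serverIteration (hF : R.Fair) (hN : 2 ≤ N) (i : Fin N) (m : ℕ) :
    ∃ n₀, ∀ n, n₀ ≤ n → R.ServerIteration i m n := by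
  have : Nontrivial (Fin N) := Fin.nontrivial_iff_two_le.2 hN
  obtain ⟨l, hl⟩ := exists_ne i
  obtain ⟨s, a, hms, hs, ha⟩ := hF.exists_receivedAt_of_gossipSend hl m
  have hround : ∀ j, ∃ n₀, j ≠ i → ∃ b b' d d', a < b ∧ R.act b = .gossipSend i j ∧
      R.ReceivedAt i j b b' ∧ b' < d ∧ R.act d = .gossipSend j i ∧ R.ReceivedAt j i d d' ∧
      d' < n₀ := by
    intro j
    by_cases hj : j = i
    · exact ⟨0, fun h => absurd hj h⟩
    · obtain ⟨b, b', hab, hb, hb'⟩ := hF.exists_receivedAt_of_gossipSend (Ne.symm hj) (a + 1)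
      obtain ⟨d, d', hbd, hd, hd'⟩ := hF.exists_receivedAt_of_gossipSend hj (b' + 1)
      exact ⟨d' + 1, fun _ => ⟨b, b', d, d', hab, hb, hb', hbd, hd, hd', d'.lt_succ_self⟩⟩
  choose f hf using hround
  refine ⟨Finset.univ.sup f, fun n hn => ⟨a, hms.trans ha.1.le,
    ⟨l, _, hl, deliversGossip_of_receivedAt hs ha⟩, fun j hj => ?_⟩⟩
  obtain ⟨b, b', d, d', hab, hb, hb', hbd, hd, hd', hlt⟩ := hf j hj
  exact ⟨b, b', d, d', hab, hb, hb', hbd, hd, hd',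
    hlt.trans_le ((Finset.le_sup (Finset.mem_univ j)).trans hn)⟩

end Fair

theorem busy_of_forall_ne_ret {r : Round N Sec} {acks : Fin N → Option (Reply N Word)}
    (hmn : m ≤ n) (hm : (R.st m).client i = .busy r acks)
    (hret : ∀ p, m ≤ p → p < n → R.act p ≠ .ret i) :
    ∃ acks', (R.st n).client i = .busy r acks' ∧ ∀ j, acks j ≠ none → acks' j ≠ none := by
  induction n, hmn using Nat.le_induction with
  | base => exact ⟨acks, hm, fun _ => id⟩
  | succ n hmn ih =>
    obtain ⟨acks', hn, hacks⟩ := ih fun p hp hp' => hret p hp (hp'.trans n.lt_succ_self)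
    rcases (R.step n).clientStep i with ⟨-, heq⟩ | ⟨_, hidle, -⟩ | ⟨hidle, -⟩ |
      ⟨r', acks'', j, a, -, hbusy, hbusy', -⟩ | ⟨_, _, hx, -⟩
    · exact ⟨acks', heq.trans hn, hacks⟩
    · simp [hn] at hidle
    · simp [hn] at hidle
    · obtain ⟨rfl, rfl⟩ := Client.busy.inj (hn.symm.trans hbusy)
      refine ⟨_, hbusy', fun j' hj' => ?_⟩
      by_cases h : j' = j
      · simp [h]
      · simpa [h] using hacks j' hj'
    · exact absurd hx (hret n hmn n.lt_succ_self)

namespace Fair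

variable {r : Round N Sec}

theorem exists_ack_self (hF : R.Fair)
    (hb : ∀ n, m ≤ n → ∃ acks, (R.st n).client i = .busy r acks) :
    ∃ n acks, m ≤ n ∧ (R.st n).client i = .busy r acks ∧ acks i ≠ none := by
  obtain ⟨n, hmn, hn⟩ := hF.exists_act (x := .localAccess i) id fun p hp => by
    obtain ⟨acks, hc⟩ := hb p hp
    obtain ⟨S', a, hserve⟩ := exists_serve (i ∈ P.corrupt) ((R.st p).store i) (r.request P i)
    exact ⟨_, r, acks, hc, S', a, hserve, rfl⟩
  obtain ⟨r', acks, hc, S', a, -, hstep⟩ : Step P _ (.localAccess i) _ := hn ▸ R.step n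
  obtain ⟨acks', hc'⟩ := hb n hmn
  obtain ⟨rfl, rfl⟩ := Client.busy.inj (hc'.symm.trans hc)
  exact ⟨n + 1, _, hmn.trans n.le_succ, by rw [hstep]; exact Function.update_self _ _ _, by simp⟩

theorem exists_ack_of_ne (hF : R.Fair) (hij : i ≠ j)
    (hb : ∀ n, m ≤ n → ∃ acks, (R.st n).client i = .busy r acks) :
    ∃ n acks, m ≤ n ∧ (R.st n).client i = .busy r acks ∧ acks j ≠ none := by
  obtain ⟨s, hms, hs⟩ := hF.exists_act (x := .requestSend i j) id fun p hp => by
    obtain ⟨acks, hc⟩ := hb p hp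
    exact ⟨_, hij, r, acks, hc, rfl⟩
  have hrequest : (R.st (s + 1)).chan i j = (R.st s).chan i j ++ [.request (r.request P j)] := by
    obtain ⟨-, r', acks, hc, hstep⟩ : Step P _ (.requestSend i j) _ := hs ▸ R.step s
    obtain ⟨acks', hc'⟩ := hb s hms
    obtain ⟨rfl, -⟩ := Client.busy.inj (hc'.symm.trans hc)
    simp [hstep, setChan_apply]
  obtain ⟨d, hd⟩ := hF.exists_receivedAt hij (s := s) (by simp [hrequest])
  obtain ⟨a, hreply, -⟩ :=
    (hd.2.1 ▸ R.step d : Step P _ (.recv i j) _).recv_request (head?_of_receivedAt hd hrequest)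
  obtain ⟨x, hx⟩ := hF.exists_receivedAt (Ne.symm hij) (s := d) (by simp [hreply])
  have hmx : m ≤ x := hms.trans (hd.1.le.trans hx.1.le)
  obtain ⟨acks, hc⟩ := hb x hmx
  exact ⟨x + 1, _, hmx.trans x.le_succ, (hx.2.1 ▸ R.step x : Step P _ (.recv j i) _).recv_ack
    (head?_of_receivedAt hx hreply) hc, by simp⟩

theorem exists_forall_ack (hF : R.Fair) (hret : ∀ p, m ≤ p → R.act p ≠ .ret i)
    (hm : (R.st m).client i ≠ .idle) : ∃ n₀, m ≤ n₀ ∧ ∀ n, n₀ ≤ n →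
      ∃ r acks, (R.st n).client i = .busy r acks ∧ ∀ j, acks j ≠ none := by
  obtain ⟨r, acks₀, hc⟩ : ∃ r acks, (R.st m).client i = .busy r acks := by
    cases h : (R.st m).client i with
    | idle => exact absurd h hm
    | busy r acks => exact ⟨r, acks, rfl⟩
  have hb : ∀ n, m ≤ n → ∃ acks, (R.st n).client i = .busy r acks := fun n hn =>
    let ⟨acks, h, _⟩ := busy_of_forall_ne_ret hn hc fun p hp _ => hret p hp
    ⟨acks, h⟩
  have hack : ∀ j, ∃ n acks, m ≤ n ∧ (R.st n).client i = .busy r acks ∧ acks j ≠ none := by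
    intro j
    by_cases hij : i = j
    · exact hij ▸ hF.exists_ack_self hb
    · exact hF.exists_ack_of_ne hij hb
  choose f acks' hmf hbusy hne using hack
  refine ⟨m ⊔ Finset.univ.sup f, le_sup_left, fun n hn => ?_⟩
  obtain ⟨acks, hacks⟩ := hb n (le_sup_left.trans hn)
  refine ⟨r, acks, hacks, fun j => ?_⟩
  have hfn : f j ≤ n := (Finset.le_sup (Finset.mem_univ j)).trans (le_sup_right.trans hn)
  obtain ⟨acks'', hacks'', hmono⟩ :=
    busy_of_forall_ne_ret hfn (hbusy j) fun p hp _ => hret p ((hmf j).trans hp)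
  obtain ⟨-, rfl⟩ := Client.busy.inj (hacks''.symm.trans hacks)
  exact hmono j (hne j)

theorem exists_ret (hF : R.Fair) (hk : k + 2 * e ≤ N) (hm : (R.st m).client i ≠ .idle) :
    ∃ n, m ≤ n ∧ R.act n = .ret i := by
  by_contra! hret
  obtain ⟨n₀, hmn₀, hack⟩ := hF.exists_forall_ack hret hm
  obtain ⟨n, hn, hact⟩ := hF.exists_act (x := .ret i) (m := n₀) id fun q hq => by
    obtain ⟨r, acks, hacks, hall⟩ := hack q hq
    refine ⟨_, r, acks, hacks, ?_, rfl⟩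
    rw [IsQuorum, Finset.filter_true_of_mem fun j _ => hall j, Finset.card_univ, Fintype.card_fin]
    omega
  exact hret n (hmn₀.trans hn) hact

theorem exists_isCycle (hF : R.Fair) (hN : 2 ≤ N) (hk : k + 2 * e ≤ N) (m : ℕ) :
    ∃ n, R.IsCycle m n := by
  choose f hf using fun i => hF.exists_serverIteration hN i m
  have hround : ∀ i, ∃ n₀, (∃ p, m ≤ p ∧ (R.st p).client i ≠ .idle) →
      ∃ q, m ≤ q ∧ q < n₀ ∧ R.act q = .ret i := by
    intro i
    by_cases hi : ∃ p, m ≤ p ∧ (R.st p).client i ≠ .idle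
    · obtain ⟨p, hmp, hp⟩ := hi
      obtain ⟨q, hpq, hq⟩ := hF.exists_ret hk hp
      exact ⟨q + 1, fun _ => ⟨q, hmp.trans hpq, q.lt_succ_self, hq⟩⟩
    · exact ⟨0, fun h => absurd h hi⟩
  choose g hg using hround
  have hcovers : ∃ n, m ≤ n ∧ R.Covers m n := by
    refine ⟨m ⊔ Finset.univ.sup f ⊔ Finset.univ.sup g, le_sup_left.trans le_sup_left,
      fun i => hf i _ ?_, fun i => ?_⟩
    · exact (Finset.le_sup (Finset.mem_univ i)).trans (le_sup_right.trans le_sup_left)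
    · rintro ⟨p, hmp, -, hp⟩
      obtain ⟨q, hmq, hqg, hq⟩ := hg i ⟨p, hmp, hp⟩
      exact ⟨q, hmq, hqg.trans_le ((Finset.le_sup (Finset.mem_univ i)).trans le_sup_right), hq⟩
  exact ⟨Nat.find hcovers, (Nat.find_spec hcovers).1, (Nat.find_spec hcovers).2,
    fun n' hmn' hn' h => Nat.find_min hcovers hn' ⟨hmn', h⟩⟩

end Fair

/-! ### What happens in a cycle -/

theorem acks_eq_none_of_idle (h : (R.st n).client i = .idle) :
    ((R.st n).client i).acks = fun _ => none := by
  rw [h, Client.acks]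

theorem client_of_ret (h : R.act n = .ret i) : ∃ r acks, (R.st n).client i = .busy r acks ∧
    IsQuorum k e (Finset.univ.filter fun j => acks j ≠ none) ∧
    (R.st (n + 1)).client i = nextClient i r acks := by
  obtain ⟨r, acks, hbusy, hquorum, hstep⟩ : Step P _ (.ret i) _ := h ▸ R.step n
  exact ⟨r, acks, hbusy, hquorum, by rw [hstep]; exact Function.update_self _ _ _⟩

theorem rank_antitone (hmn : m ≤ n) (h : ∀ p, m ≤ p → p < n → (R.st p).client i ≠ .idle) :
    ((R.st n).client i).rank ≤ ((R.st m).client i).rank := by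
  induction n, hmn using Nat.le_induction with
  | base => exact le_rfl
  | succ n hmn ih =>
    exact (((R.step n).clientStep i).rank_le (h n hmn n.lt_succ_self)).trans
      (ih fun p hp hp' => h p hp (hp'.trans n.lt_succ_self))

theorem act_eq_ret_of_idle (h : (R.st n).client i ≠ .idle)
    (h' : (R.st (n + 1)).client i = .idle) : R.act n = .ret i := by
  rcases (R.step n).clientStep i with ⟨-, heq⟩ | ⟨_, hidle, -⟩ | ⟨hidle, -⟩ |
    ⟨r, acks, j, a, -, -, hbusy, -⟩ | ⟨_, _, hx, -⟩
  · exact absurd (heq.symm.trans h') h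
  · exact absurd hidle h
  · exact absurd hidle h
  · simp [hbusy] at h'
  · exact hx

namespace Covers

theorem lt (hC : R.Covers m n) : m < n := by
  obtain ⟨a, hma, ⟨l, g, hl, -⟩, hround⟩ := hC.1 0
  obtain ⟨b, b', d, d', hab, -, hb', hbd, -, hd', hdn⟩ := hround l hl
  exact hma.trans_lt (hab.trans (hb'.1.trans (hbd.trans (hd'.1.trans hdn))))

theorem exists_receivedAt (hC : R.Covers m n) (hij : i ≠ j) :
    ∃ a b d, m ≤ a ∧ (∃ l g, l ≠ i ∧ R.DeliversGossip l i g a) ∧ a < b ∧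
      R.act b = .gossipSend i j ∧ R.ReceivedAt i j b d ∧ d < n := by
  obtain ⟨a, hma, hg, hround⟩ := hC.1 i
  obtain ⟨b, b', d, d', hab, hb, hb', hbd, -, hd', hdn⟩ := hround j hij.symm
  exact ⟨a, b, b', hma, hg, hab, hb, hb', hbd.trans (hd'.1.trans hdn)⟩

/-- By the FIFO order, the arrival of a gossip message that is sent in the cycle flushes the channel
of all messages that it holds when the cycle begins. -/
theorem length_sent_le_received (hC : R.Covers m n) (hij : i ≠ j) :
    (R.sent i j m).length ≤ R.received i j n := by
  obtain ⟨a, b, d, hma, -, hab, -, hd, hdn⟩ := hC.exists_receivedAt hij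
  obtain ⟨-, hact, hr⟩ := receivedAt_iff.1 hd
  calc (R.sent i j m).length ≤ (R.sent i j (b + 1)).length := length_sent_mono (by omega)
    _ = R.received i j (d + 1) := by rw [← hr, received_succ_of_eq hact]
    _ ≤ R.received i j n := received_mono hdn

theorem lt_of_receivedAt (hC : R.Covers m n) (hij : i ≠ j) {s d : ℕ} (hs : s < m)
    (h : R.ReceivedAt i j s d) : d < n := by
  by_contra! hnd
  obtain ⟨-, -, hr⟩ := receivedAt_iff.1 h
  have hreceived := calc R.received i j d + 1
      _ = (R.sent i j (s + 1)).length := hr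
      _ ≤ (R.sent i j m).length := length_sent_mono hs
      _ ≤ R.received i j n := hC.length_sent_le_received hij
      _ ≤ R.received i j d := received_mono hnd
  omega

theorem lt_of_receivesInitial (hC : R.Covers m n) (hij : i ≠ j) {d : ℕ}
    (h : R.ReceivesInitial i j d) : d < n := by
  by_contra! hnd
  refine (receivesInitial_iff.1 h).2.not_ge ?_
  calc (R.sent i j 0).length ≤ (R.sent i j m).length := length_sent_mono m.zero_le
    _ ≤ R.received i j n := hC.length_sent_le_received hij
    _ ≤ R.received i j d := received_mono hnd

theorem rank_lt (hC : R.Covers m n) (h : ∀ p, m ≤ p → p < n → (R.st p).client i ≠ .idle) :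
    ((R.st n).client i).rank < ((R.st m).client i).rank := by
  obtain ⟨q, hmq, hqn, hq⟩ := hC.2 i ⟨m, le_rfl, hC.lt, h m le_rfl hC.lt⟩
  obtain ⟨r, acks, hbusy, -, hnext⟩ := client_of_ret hq
  calc ((R.st n).client i).rank ≤ ((R.st (q + 1)).client i).rank :=
        rank_antitone hqn fun p hp => h p (by omega)
    _ < ((R.st q).client i).rank := by
        rw [hbusy, hnext, ← rank_nextClient i]
        exact Nat.lt_succ_self _
    _ ≤ ((R.st m).client i).rank := rank_antitone hmq fun p hp hp' => h p hp (hp'.trans hqn)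

theorem exists_acks_eq_none (hC : R.Covers m n) (i : Fin N) :
    ∃ p, m ≤ p ∧ p ≤ n ∧ ((R.st p).client i).acks = fun _ => none := by
  by_cases hm : (R.st m).client i = .idle
  · exact ⟨m, le_rfl, hC.lt.le, acks_eq_none_of_idle hm⟩
  · obtain ⟨q, hmq, hqn, hq⟩ := hC.2 i ⟨m, le_rfl, hC.lt, hm⟩
    obtain ⟨r, acks, -, -, hnext⟩ := client_of_ret hq
    exact ⟨q + 1, by omega, hqn, by rw [hnext, acks_nextClient]⟩

end Covers

/-! ### Sequences of cycles and the duration of operations -/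

/-- `cyc t` is the state in which the `t`-th asynchronous cycle of the execution ends. -/
structure IsCycleSeq (R : Execution P) (cyc : ℕ → ℕ) : Prop where
  zero : cyc 0 = 0
  isCycle : ∀ t, R.IsCycle (cyc t) (cyc (t + 1))

theorem Fair.exists_isCycleSeq (hF : R.Fair) (hN : 2 ≤ N) (hk : k + 2 * e ≤ N) :
    ∃ cyc, R.IsCycleSeq cyc := by
  choose f hf using hF.exists_isCycle hN hk
  exact ⟨fun t => Nat.rec 0 (fun _ m => f m) t, rfl, fun t => hf _⟩

theorem client_of_isWriteOp {b : ℕ} (h : R.IsWriteOp i b) (hb : b ≠ 0) :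
    ∃ s, (R.st b).client i = .busy (.wQry s) fun _ => none := by
  obtain ⟨⟨-, -, hidle⟩, r, acks, hbusy, hwrite⟩ := h
  obtain ⟨n, rfl⟩ := Nat.exists_eq_succ_of_ne_zero hb
  have hidle : (R.st n).client i = .idle := hidle.resolve_left hb
  rcases (R.step n).clientStep i with ⟨-, heq⟩ | ⟨s, -, hinvoke⟩ | ⟨-, hinvoke⟩ |
    ⟨r, acks, _, _, -, hbusy', -⟩ | ⟨r, acks, -, hbusy', -⟩
  · simp [heq, hidle] at hbusy
  · exact ⟨s, hinvoke⟩
  · rw [Nat.succ_eq_add_one, hinvoke] at hbusy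
    obtain ⟨rfl, -⟩ := Client.busy.inj hbusy
    exact hwrite.elim
  · simp [hidle] at hbusy'
  · simp [hidle] at hbusy'

namespace IsCycleSeq

variable {cyc : ℕ → ℕ} {b t : ℕ}

theorem covers (hc : R.IsCycleSeq cyc) (t : ℕ) : R.Covers (cyc t) (cyc (t + 1)) :=
  (hc.isCycle t).2.1

theorem strictMono (hc : R.IsCycleSeq cyc) : StrictMono cyc :=
  strictMono_nat_of_lt_succ fun t => (hc.covers t).lt

theorem mono (hc : R.IsCycleSeq cyc) {s t : ℕ} (h : s ≤ t) : cyc s ≤ cyc t :=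
  hc.strictMono.monotone h

theorem withinCycles (hc : R.IsCycleSeq cyc) (s C : ℕ) :
    R.WithinCycles (cyc s) C (cyc (s + C)) := by
  refine ⟨cyc (s + C), ?_, hc.mono (Nat.le_add_right s C), le_rfl⟩
  induction C with
  | zero => rfl
  | succ C ih => exact ⟨_, ih, hc.isCycle _⟩

theorem rank_add_le (hc : R.IsCycleSeq cyc) {s : ℕ}
    (h : ∀ p, cyc t ≤ p → p < cyc (t + s) → (R.st p).client i ≠ .idle) :
    ((R.st (cyc (t + s))).client i).rank + s ≤ ((R.st (cyc t)).client i).rank := by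
  induction s with
  | zero => rfl
  | succ s ih =>
    have hs : cyc (t + s) < cyc (t + (s + 1)) := (hc.covers (t + s)).lt
    have hprev := ih fun p hp hp' => h p hp (hp'.trans hs)
    have hlast : ((R.st (cyc (t + (s + 1)))).client i).rank <
        ((R.st (cyc (t + s))).client i).rank :=
      (hc.covers (t + s)).rank_lt fun p hp => h p ((hc.mono (Nat.le_add_right t s)).trans hp)
    omega

theorem exists_idle (hc : R.IsCycleSeq cyc) (t : ℕ) (i : Fin N) :
    ∃ p, cyc t ≤ p ∧ p ≤ cyc (t + 4) ∧ (R.st p).client i = .idle := by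
  by_contra! hne
  have hrank := hc.rank_add_le (s := 4) fun p hp hp' => hne p hp hp'.le
  have hle := ((R.st (cyc t)).client i).rank_le
  exact hne _ (hc.mono (Nat.le_add_right t 4)) le_rfl (Client.rank_eq_zero_iff.1 (by omega))

theorem lt_of_ongoing (hc : R.IsCycleSeq cyc) (hb : b ≤ cyc t) (h : R.Ongoing i b n) :
    n < cyc (t + 4) := by
  obtain ⟨p, htp, hp, hidle⟩ := hc.exists_idle t i
  by_contra! hn
  exact h.2.1 p (hb.trans htp) (hp.trans hn) hidle

theorem lt_of_opStep (hc : R.IsCycleSeq cyc) (hb : b ≤ cyc t) (h : R.OpStep i b n) :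
    n < cyc (t + 6) := by
  have h45 : cyc (t + 4) ≤ cyc (t + 5) := hc.mono (by omega)
  have h56 : cyc (t + 5) ≤ cyc (t + 6) := hc.mono (by omega)
  have hinitial {d : ℕ} {i j : Fin N} (h : R.ReceivesInitial i j d) : d < cyc (t + 4) :=
    (hc.covers (t + 3)).lt_of_receivesInitial (h.1 ▸ R.step d : Step P _ (.recv i j) _).ne_of_recv h
  -- The client stops within 4 cycles, and its requests and then the replies take one more each.
  suffices n < cyc (t + 4) ∨ (n < cyc (t + 5) ∧ ∃ l, R.act n = .recv i l) ∨
      (n < cyc (t + 6) ∧ ∃ l, R.act n = .recv l i) by omega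
  induction h with
  | invocation n hn _ => exact .inl (by have := hc.mono (Nat.le_add_right t 4); omega)
  | client n h => exact .inl (hc.lt_of_ongoing hb h)
  | initialRequest n j _ _ h => exact .inl (hinitial h)
  | initialReply n j _ _ _ h => exact .inl (hinitial h)
  | request s n j _ hs h ih =>
    have hij := (h.2.1 ▸ R.step n : Step P _ (.recv i j) _).ne_of_recv
    have hs : s < cyc (t + 4) := by simpa [hs] using ih
    exact .inr (.inl ⟨(hc.covers (t + 4)).lt_of_receivedAt hij hs h, j, h.2.1⟩)
  | reply s n j _ hs h ih =>
    have hji := (h.2.1 ▸ R.step n : Step P _ (.recv j i) _).ne_of_recv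
    have hs : s < cyc (t + 5) := by
      rcases ih with ih | ih | ⟨-, l, hl⟩
      · exact ih.trans_le h45
      · exact ih.1
      · rw [hs, Action.recv.injEq] at hl
        exact absurd hl.2 hji
    exact .inr (.inr ⟨(hc.covers (t + 5)).lt_of_receivedAt hji hs h, j, h.2.1⟩)

theorem lt_of_suffixIncludes (hc : R.IsCycleSeq cyc) (h : R.SuffixIncludes (cyc (t + 6)) i b) :
    cyc t < b := by
  by_contra! hb
  obtain ⟨n, hn, hongoing | hstep⟩ := h
  · exact (hc.lt_of_ongoing hb hongoing).not_ge ((hc.mono (by omega)).trans hn)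
  · exact (hc.lt_of_opStep hb hstep).not_ge hn

theorem complete_of_ongoing (hc : R.IsCycleSeq cyc) (hb : b ≠ 0) (h : R.Ongoing i b b) :
    R.Complete i b := by
  have hidle : ∃ n, b < n + 1 ∧ (R.st (n + 1)).client i = .idle := by
    obtain ⟨p, hbp, -, hp⟩ := hc.exists_idle b i
    have hbp : b ≤ p := (hc.strictMono.le_apply).trans hbp
    have hne : b ≠ p := fun hbp => h.2.1 b le_rfl le_rfl (hbp ▸ hp)
    exact ⟨p - 1, by omega, by rwa [show p - 1 + 1 = p by omega]⟩
  obtain ⟨hbn, hn⟩ := Nat.find_spec hidle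
  have hbusy : ∀ p, b ≤ p → p ≤ Nat.find hidle → (R.st p).client i ≠ .idle := by
    intro p hbp hp hpidle
    have hne : b ≠ p := fun hbp => h.2.1 b le_rfl le_rfl (hbp ▸ hpidle)
    exact Nat.find_min hidle (m := p - 1) (by omega)
      ⟨by omega, by rwa [show p - 1 + 1 = p by omega]⟩
  exact ⟨hb, Nat.find hidle, ⟨by omega, hbusy, h.2.2⟩,
    act_eq_ret_of_idle (hbusy _ (by omega) le_rfl) hn, hn⟩

end IsCycleSeq

/-! ### The tags that servers store -/

/-- The tags that some server stores in state `n`, together with the least tag, which servers report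
when they store nothing. -/
def storedTags (R : Execution P) (n : ℕ) : Set (Tag N) :=
  insert ⊥ (⋃ i, storeTags ((R.st n).store i))

theorem storeTags_mono (hmn : m ≤ n) (i : Fin N) :
    storeTags ((R.st m).store i) ⊆ storeTags ((R.st n).store i) :=
  monotone_nat_of_le_succ (f := fun n => storeTags ((R.st n).store i))
    (fun n => (R.step n).storeTags_subset i) hmn

theorem storedTags_mono (hmn : m ≤ n) : R.storedTags m ⊆ R.storedTags n :=
  Set.insert_subset_insert (Set.iUnion_mono (storeTags_mono hmn))

theorem insert_storeTags_subset_storedTags (i : Fin N) :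
    insert ⊥ (storeTags ((R.st n).store i)) ⊆ R.storedTags n :=
  Set.insert_subset_insert (Set.subset_iUnion (fun i => storeTags ((R.st n).store i)) i)

theorem storeTags_subset_storedTags (i : Fin N) :
    storeTags ((R.st n).store i) ⊆ R.storedTags n :=
  (Set.subset_insert _ _).trans (insert_storeTags_subset_storedTags i)

theorem tags_subset_of_serve {c : Prop} {q : Request N Word} {a : Reply N Word} (hmn : m < n)
    (h : Serve c ((R.st m).store i) q ((R.st (m + 1)).store i) a) :
    insert a.tag q.tags ⊆ R.storedTags n := by
  refine Set.insert_subset (storedTags_mono hmn ?_) fun u hu => storedTags_mono hmn ?_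
  · exact insert_storeTags_subset_storedTags i h.reply_tag_mem
  · exact storeTags_subset_storedTags i (h.mem_storeTags.2 (.inr hu))

namespace DeliversGossip

variable {g : Triple N}

theorem exists_gossipUpdate (h : R.DeliversGossip i j g n) :
    ∃ m, GossipUpdate k e j (Function.update ((R.st n).gossip j) i g) ((R.st n).store j)
        ((R.st (n + 1)).store j) m ∧
      (R.st (n + 1)).gossip j = Function.update (Function.update ((R.st n).gossip j) i g) j m ∧
      (R.st (n + 1)).gossipTx j = tagTuple ((R.st (n + 1)).store j) :=
  (h.1 ▸ R.step n : Step P _ (.recv i j) _).recv_gossip h.2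

theorem pre_le_maxPhase (h : R.DeliversGossip i j g n) :
    g.pre ≤ maxPhase ((R.st (n + 1)).store j) Set.univ := by
  obtain ⟨m, hm, -, -⟩ := h.exists_gossipUpdate
  have hpre : g.pre ≤ m.pre := by simpa only [Function.update_self] using hm.le_pre i
  exact hpre.trans (le_maxPhase_univ (hm.mem_storeTags.2 (.inr (.inl rfl))))

end DeliversGossip

theorem gossip_eq_or_deliversGossip (n : ℕ) (j : Fin N) :
    ((R.st (n + 1)).gossip j = (R.st n).gossip j ∧
      (R.st (n + 1)).gossipTx j = (R.st n).gossipTx j) ∨ ∃ i g, R.DeliversGossip i j g n := by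
  rcases (R.step n).gossip_eq_or_recv_gossip j with heq | ⟨i, g, hact, hhead⟩
  · exact .inl heq
  · exact .inr ⟨i, g, hact, hhead⟩

theorem DeliversGossip.exists_gossipTx_eq {a : ℕ} {g : Triple N} (h : R.DeliversGossip j i g a)
    (hn : a < n) : ∃ s, a < s ∧ s ≤ n ∧ (R.st n).gossipTx i = tagTuple ((R.st s).store i) := by
  induction n, hn using Nat.le_induction with
  | base =>
    obtain ⟨-, -, -, htx⟩ := h.exists_gossipUpdate
    exact ⟨a + 1, a.lt_succ_self, le_rfl, htx⟩
  | succ n hn ih =>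
    rcases R.gossip_eq_or_deliversGossip n i with ⟨-, heq⟩ | ⟨l, g', h'⟩
    · obtain ⟨s, has, hsn, htx⟩ := ih
      exact ⟨s, has, hsn.trans n.le_succ, heq.trans htx⟩
    · obtain ⟨-, -, -, htx⟩ := h'.exists_gossipUpdate
      exact ⟨n + 1, by omega, le_rfl, htx⟩

namespace Covers

theorem exists_deliversGossip (hC : R.Covers m n) (i : Fin N) :
    ∃ a l g, m ≤ a ∧ a < n ∧ R.DeliversGossip l i g a := by
  obtain ⟨a, hma, ⟨l, g, hl, hg⟩, hround⟩ := hC.1 i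
  obtain ⟨b, b', d, d', hab, -, hb', hbd, -, hd', hdn⟩ := hround l hl
  exact ⟨a, l, g, hma, hab.trans (hb'.1.trans (hbd.trans (hd'.1.trans hdn))), hg⟩

/-- What a server sends in its iteration stems from its storage, since gossip arrives first. -/
theorem exists_deliversGossip_of_ne (hC : R.Covers m n) (hij : i ≠ j) :
    ∃ s d, m ≤ s ∧ s ≤ d ∧ d < n ∧ R.DeliversGossip i j (tagTuple ((R.st s).store i)) d := by
  obtain ⟨a, b, d, hma, ⟨l, g, -, hg⟩, hab, hb, hd, hdn⟩ := hC.exists_receivedAt hij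
  obtain ⟨s, has, hsb, hs⟩ := hg.exists_gossipTx_eq hab
  exact ⟨s, d, hma.trans has.le, hsb.trans hd.1.le, hdn, hs ▸ deliversGossip_of_receivedAt hb hd⟩

theorem le_maxPhase (hC : R.Covers m n) {t : Tag N} (ht : t ∈ R.storedTags m) (i : Fin N) :
    t ≤ maxPhase ((R.st n).store i) Set.univ := by
  rcases ht with rfl | ht
  · exact bot_le
  obtain ⟨j, hj⟩ := Set.mem_iUnion.1 ht
  by_cases hji : j = i
  · exact le_maxPhase_univ (storeTags_mono hC.lt.le i (hji ▸ hj))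
  · obtain ⟨s, d, hms, -, hdn, hd⟩ := hC.exists_deliversGossip_of_ne hji
    calc t ≤ maxPhase ((R.st s).store j) Set.univ := le_maxPhase_univ (storeTags_mono hms j hj)
      _ ≤ maxPhase ((R.st (d + 1)).store i) Set.univ := hd.pre_le_maxPhase
      _ ≤ maxPhase ((R.st n).store i) Set.univ := maxPhase_univ_mono (storeTags_mono hdn i)

end Covers

/-! ### The acknowledgments that clients collect -/

theorem exists_serve_of_acks {m₀ : ℕ} (hm₀ : m₀ ≤ m)
    (hflush : ∀ j, j ≠ i → (R.sent j i m₀).length ≤ R.received j i m)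
    (hnone : ((R.st m).client i).acks = fun _ => none) (hmn : m ≤ n) {r : Round N Sec}
    {acks : Fin N → Option (Reply N Word)} (hbusy : (R.st n).client i = .busy r acks)
    {a : Reply N Word} (ha : acks j = some a) :
    ∃ s, m₀ ≤ s ∧ s < n ∧ Serve (j ∈ P.corrupt) ((R.st s).store j) (r.request P j)
      ((R.st (s + 1)).store j) a := by
  induction n, hmn using Nat.le_induction generalizing r acks j a with
  | base =>
    rw [hbusy, Client.acks] at hnone
    simp [hnone] at ha
  | succ n hmn ih =>
    have hacks : ((R.st (n + 1)).client i).acks j = some a := by rwa [hbusy]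
    replace ih {j : Fin N} {acks : Fin N → Option (Reply N Word)} {a : Reply N Word}
        (hbusy : (R.st n).client i = .busy r acks) (ha : acks j = some a) :
        ∃ s, m₀ ≤ s ∧ s < n + 1 ∧ Serve (j ∈ P.corrupt) ((R.st s).store j) (r.request P j)
          ((R.st (s + 1)).store j) a :=
      (ih hbusy ha).imp fun s => .imp_right (.imp_left (·.trans n.lt_succ_self))
    rcases (R.step n).clientStep i with ⟨-, heq⟩ | ⟨s, -, hinvoke⟩ | ⟨-, hinvoke⟩ |
      ⟨r', acks', l, a', -, hbusy', hcollect, hprovenance⟩ | ⟨r', acks', -, -, -, hnext⟩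
    · exact ih (heq.symm.trans hbusy) ha
    · simp [hinvoke, Client.acks] at hacks
    · simp [hinvoke, Client.acks] at hacks
    · obtain ⟨rfl, rfl⟩ := Client.busy.inj (hcollect.symm.trans hbusy)
      by_cases hjl : j = l
      · subst hjl
        obtain rfl : a' = a := by simpa using ha
        rcases hprovenance with ⟨hji, hmem⟩ | hserve
        · obtain ⟨s, hs, hsn, hsend⟩ := exists_sends_of_mem_chan (hm₀.trans hmn)
            ((hflush j hji).trans (received_mono hmn)) hmem
          cases hsend with
          | ack q a hserve => exact ⟨s, hs, hsn.trans n.lt_succ_self, hserve⟩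
        · exact ⟨n, hm₀.trans hmn, n.lt_succ_self, hserve⟩
      · exact ih hbusy' (by rwa [Function.update_of_ne hjl] at ha)
    · simp [hnext, acks_nextClient] at hacks

theorem exists_isLeast_ret {r : Round N Sec} {acks : Fin N → Option (Reply N Word)}
    (hbusy : (R.st m).client i = .busy r acks) (h : ∃ n, m ≤ n ∧ R.act n = .ret i) :
    ∃ n acks', IsLeast {n | m ≤ n ∧ R.act n = .ret i} n ∧ (R.st n).client i = .busy r acks' ∧
      (∃ j a, acks' j = some a) ∧ (R.st (n + 1)).client i = nextClient i r acks' := by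
  obtain ⟨n, hn⟩ : ∃ n, IsLeast {n | m ≤ n ∧ R.act n = .ret i} n :=
    ⟨Nat.find h, Nat.find_spec h, fun n => Nat.find_min' h⟩
  obtain ⟨acks', hbusy', -⟩ := busy_of_forall_ne_ret hn.1.1 hbusy
    fun p hp hpn hret => (hn.2 ⟨hp, hret⟩).not_gt hpn
  obtain ⟨r', b, hret, hquorum, hnext⟩ := client_of_ret hn.1.2
  obtain ⟨rfl, rfl⟩ := Client.busy.inj (hbusy'.symm.trans hret)
  obtain ⟨j, hj⟩ := hquorum.nonempty
  exact ⟨n, acks', hn, hbusy', ⟨j, Option.ne_none_iff_exists'.1 (Finset.mem_filter.1 hj).2⟩, hnext⟩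

/-! ### Tags that no server stores -/

namespace IsCycleSeq

variable {cyc : ℕ → ℕ} {b t : ℕ}

theorem exists_sends_of_mem_chan (hc : R.IsCycleSeq cyc) (hij : i ≠ j) (hn : cyc (t + 1) ≤ n)
    {x : Msg N Word} (hx : x ∈ (R.st n).chan i j) :
    ∃ s, cyc t ≤ s ∧ s < n ∧ Sends P i j (R.st s) (R.st (s + 1)) x :=
  Execution.exists_sends_of_mem_chan ((hc.mono t.le_succ).trans hn)
    (((hc.covers t).length_sent_le_received hij).trans (received_mono hn)) hx

theorem gossipTx_tags_subset (hc : R.IsCycleSeq cyc) (hn : cyc 1 ≤ n) (i : Fin N) :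
    ((R.st n).gossipTx i).tags ⊆ R.storedTags n := by
  obtain ⟨a, l, g, -, han, hg⟩ := (hc.covers 0).exists_deliversGossip i
  obtain ⟨s, -, hsn, hs⟩ := hg.exists_gossipTx_eq (han.trans_le hn)
  calc ((R.st n).gossipTx i).tags = (tagTuple ((R.st s).store i)).tags := by rw [hs]
    _ ⊆ insert ⊥ (storeTags ((R.st s).store i)) := tagTuple_tags_subset _
    _ ⊆ R.storedTags s := insert_storeTags_subset_storedTags i
    _ ⊆ R.storedTags n := storedTags_mono hsn

theorem tags_subset_of_gossip_mem_chan (hc : R.IsCycleSeq cyc) (hij : i ≠ j) (hn : cyc 2 ≤ n)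
    {g : Triple N} (hg : .gossip g ∈ (R.st n).chan i j) : g.tags ⊆ R.storedTags n := by
  obtain ⟨s, hs, hsn, hsend⟩ := hc.exists_sends_of_mem_chan (t := 1) hij hn hg
  cases hsend with
  | gossip => exact (hc.gossipTx_tags_subset hs i).trans (storedTags_mono hsn.le)

theorem tags_subset_of_ack_mem_chan (hc : R.IsCycleSeq cyc) (hij : i ≠ j) (hn : cyc 1 ≤ n)
    {q : Request N Word} {a : Reply N Word} (ha : .ack q a ∈ (R.st n).chan i j) :
    insert a.tag q.tags ⊆ R.storedTags n := by
  obtain ⟨s, -, hsn, hsend⟩ := hc.exists_sends_of_mem_chan (t := 0) hij hn ha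
  cases hsend with
  | ack q a hserve => exact tags_subset_of_serve hsn hserve

theorem tags_subset_of_request_mem_chan (hc : R.IsCycleSeq cyc) (hij : i ≠ j)
    {q : Request N Word} (hq : .request q ∈ (R.st (cyc t)).chan i j) :
    q.tags ⊆ R.storedTags (cyc (t + 1)) := by
  obtain ⟨d, -, hdn, hact, hhead⟩ :=
    exists_recv_of_mem_chan hq ((hc.covers t).length_sent_le_received hij)
  obtain ⟨a, -, hserve⟩ := (hact ▸ R.step d : Step P _ (.recv i j) _).recv_request hhead
  exact (Set.subset_insert _ _).trans (tags_subset_of_serve hdn hserve)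

theorem gossip_tags_subset_of_deliversGossip (hc : R.IsCycleSeq cyc) {g : Triple N} {l : Fin N}
    (hn : cyc 2 ≤ n) (hg : R.DeliversGossip i j g n)
    (hl : l = j ∨ l = i ∨ ((R.st n).gossip j l).tags ⊆ R.storedTags n) :
    ((R.st (n + 1)).gossip j l).tags ⊆ R.storedTags (n + 1) := by
  obtain ⟨m, hm, hgossip, -⟩ := hg.exists_gossipUpdate
  have hij := (hg.1 ▸ R.step n : Step P _ (.recv i j) _).ne_of_recv
  rw [hgossip]
  by_cases hlj : l = j
  · subst hlj
    rw [Function.update_self]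
    exact fun u hu => storeTags_subset_storedTags l (hm.mem_storeTags.2 (.inr hu))
  rw [Function.update_of_ne hlj]
  refine Set.Subset.trans ?_ (storedTags_mono n.le_succ)
  by_cases hli : l = i
  · subst hli
    rw [Function.update_self]
    exact hc.tags_subset_of_gossip_mem_chan hij hn (List.mem_of_mem_head? hg.2)
  · rw [Function.update_of_ne hli]
    exact (hl.resolve_left hlj).resolve_left hli

theorem gossip_tags_subset (hc : R.IsCycleSeq cyc) (hn : cyc 3 ≤ n) (j l : Fin N) :
    ((R.st n).gossip j l).tags ⊆ R.storedTags n := by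
  obtain ⟨d, i, g, hd, hdn, hg, hl⟩ : ∃ d i g, cyc 2 ≤ d ∧ d < n ∧ R.DeliversGossip i j g d ∧
      (l = j ∨ l = i) := by
    by_cases hlj : l = j
    · obtain ⟨d, i, g, hd, hdn, hg⟩ := (hc.covers 2).exists_deliversGossip j
      exact ⟨d, i, g, hd, hdn.trans_le hn, hg, .inl hlj⟩
    · obtain ⟨s, d, hs, hsd, hdn, hg⟩ := (hc.covers 2).exists_deliversGossip_of_ne hlj
      exact ⟨d, l, _, hs.trans hsd, hdn.trans_le hn, hg, .inr rfl⟩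
  clear hn
  induction n, hdn using Nat.le_induction with
  | base => exact hc.gossip_tags_subset_of_deliversGossip hd hg (hl.imp_right .inl)
  | succ n hdn ih =>
    rcases R.gossip_eq_or_deliversGossip n j with ⟨heq, -⟩ | ⟨i', g', hg'⟩
    · rw [heq]
      exact ih.trans (storedTags_mono n.le_succ)
    · exact hc.gossip_tags_subset_of_deliversGossip (by omega) hg' (.inr (.inr ih))

theorem tags_subset_of_acks (hc : R.IsCycleSeq cyc) (hn : cyc 2 ≤ n) {r : Round N Sec}
    {acks : Fin N → Option (Reply N Word)} (hbusy : (R.st n).client i = .busy r acks)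
    {a : Reply N Word} (ha : acks j = some a) : insert a.tag r.tags ⊆ R.storedTags n := by
  obtain ⟨p, hp, hpn, hnone⟩ := (hc.covers 1).exists_acks_eq_none i
  obtain ⟨s, -, hsn, hserve⟩ := exists_serve_of_acks ((hc.mono zero_le_one).trans hp)
    (fun l hl => ((hc.covers 0).length_sent_le_received hl).trans (received_mono hp)) hnone
    (hpn.trans hn) hbusy ha
  exact Round.request_tags P j r ▸ tags_subset_of_serve hsn hserve

theorem round_tags_subset (hc : R.IsCycleSeq cyc) (ht : 2 ≤ t) {r : Round N Sec}
    {acks : Fin N → Option (Reply N Word)} (hbusy : (R.st (cyc t)).client i = .busy r acks) :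
    r.tags ⊆ R.storedTags (cyc (t + 1)) := by
  obtain ⟨q, hq, hqn, hret⟩ := (hc.covers t).2 i ⟨cyc t, le_rfl, (hc.covers t).lt, by simp [hbusy]⟩
  obtain ⟨n, acks', hn, hbusy', ⟨j, a, ha⟩, -⟩ := exists_isLeast_ret hbusy ⟨q, hq, hret⟩
  calc r.tags ⊆ insert a.tag r.tags := Set.subset_insert _ _
    _ ⊆ R.storedTags n := hc.tags_subset_of_acks ((hc.mono ht).trans hn.1.1) hbusy' ha
    _ ⊆ R.storedTags (cyc (t + 1)) := storedTags_mono ((hn.2 ⟨hq, hret⟩).trans hqn.le)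

theorem client_tags_subset (hc : R.IsCycleSeq cyc) (ht : 2 ≤ t) (i : Fin N) :
    ((R.st (cyc t)).client i).tags ⊆ R.storedTags (cyc (t + 1)) := by
  intro u hu
  cases hbusy : (R.st (cyc t)).client i with
  | idle => simp [hbusy, Client.tags] at hu
  | busy r acks =>
    rw [hbusy] at hu
    rcases hu with hu | ⟨j, a, ha, rfl⟩
    · exact hc.round_tags_subset ht hbusy hu
    · exact storedTags_mono (hc.mono t.le_succ)
        (hc.tags_subset_of_acks (hc.mono ht) hbusy ha (Set.mem_insert _ _))

theorem tags_subset (hc : R.IsCycleSeq cyc) (ht : 3 ≤ t) :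
    (R.st (cyc t)).tags ⊆ R.storedTags (cyc (t + 1)) := by
  have hmono : R.storedTags (cyc t) ⊆ R.storedTags (cyc (t + 1)) :=
    storedTags_mono (hc.mono t.le_succ)
  have h1 : cyc 1 ≤ cyc t := hc.mono (by omega)
  have h2 : cyc 2 ≤ cyc t := hc.mono (by omega)
  rintro u (⟨i, hu⟩ | ⟨i, l, hu⟩ | ⟨i, hu⟩ | ⟨i, hu⟩ | ⟨i, j, hij, x, hx, hu⟩)
  · exact hmono (storeTags_subset_storedTags i hu)
  · exact hmono (hc.gossip_tags_subset (hc.mono ht) i l hu)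
  · exact hmono (hc.gossipTx_tags_subset h1 i hu)
  · exact hc.client_tags_subset (by omega) i hu
  · cases x with
    | gossip g => exact hmono (hc.tags_subset_of_gossip_mem_chan hij h2 hx hu)
    | request q => exact hc.tags_subset_of_request_mem_chan hij hx hu
    | ack q a => exact hmono (hc.tags_subset_of_ack_mem_chan hij h1 hx hu)

/-! ### The validity of write operations -/

theorem le_maxPhase (hc : R.IsCycleSeq cyc) (ht : 3 ≤ t) {u : Tag N}
    (hu : u ∈ (R.st (cyc t)).tags) (hn : cyc (t + 2) ≤ n) (i : Fin N) :
    u ≤ maxPhase ((R.st n).store i) Set.univ :=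
  ((hc.covers (t + 1)).le_maxPhase (hc.tags_subset ht hu) i).trans
    (maxPhase_univ_mono (storeTags_mono hn i))

theorem le_tag_of_wQry_acks (hc : R.IsCycleSeq cyc) (ht : 3 ≤ t) {u : Tag N}
    (hu : u ∈ (R.st (cyc t)).tags) (hb : cyc (t + 3) ≤ b) {s : Sec}
    (hstart : (R.st b).client i = .busy (.wQry s) fun _ => none) (hbn : b ≤ n)
    {acks : Fin N → Option (Reply N Word)} (hbusy : (R.st n).client i = .busy (.wQry s) acks)
    {a : Reply N Word} (ha : acks j = some a) : u ≤ a.tag := by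
  obtain ⟨p, hp, -, -, rfl⟩ := exists_serve_of_acks ((hc.mono (t + 2).le_succ).trans hb)
    (fun l hl => ((hc.covers (t + 2)).length_sent_le_received hl).trans (received_mono hb))
    (by rw [hstart, Client.acks]) hbn hbusy ha
  exact hc.le_maxPhase ht hu hp j

theorem validWrite (hc : R.IsCycleSeq cyc) (hb : cyc 6 < b) (h : R.IsWriteOp i b) :
    R.ValidWrite i b := by
  have hb0 : b ≠ 0 := Nat.ne_zero_of_lt hb
  obtain ⟨s, hstart⟩ := client_of_isWriteOp h hb0
  have hcomplete := hc.complete_of_ongoing hb0 h.1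
  obtain ⟨q, hongoing, hret, -⟩ := hcomplete.2
  obtain ⟨n, acks, hn, hbusy, ⟨j, a, ha⟩, hnext⟩ :=
    exists_isLeast_ret hstart ⟨q, hongoing.1, hret⟩
  have hnq : n ≤ q := hn.2 ⟨hongoing.1, hret⟩
  have hwrite : R.Ongoing i b (n + 1) := by
    refine ⟨hn.1.1.trans n.le_succ, fun p hbp hp => ?_, h.1.2.2⟩
    rcases Nat.le_succ_iff.1 hp with hp | rfl
    · exact hongoing.2.1 p hbp (hp.trans hnq)
    · simp [hnext, nextClient]
  refine ⟨hcomplete, _, ⟨n + 1, s, _, hwrite, hnext⟩, cyc 3, ?_, fun u hu => ?_⟩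
  · have h36 : cyc 3 < cyc 6 := hc.strictMono (by omega)
    omega
  · calc u ≤ a.tag := hc.le_tag_of_wQry_acks le_rfl hu.2 hb.le hstart hn.1.1 hbusy ha
      _ ≤ maxAck acks := le_maxAck ha
      _ < toLex ((ofLex (maxAck acks)).1 + 1, i) := Prod.Lex.lt_iff.2 (.inl (Nat.lt_succ_self _))

end IsCycleSeq

end Execution

end CAS

theorem mainTheorem3_general {N k e : ℕ} [NeZero N] {Sec : Type u} {Word : Type v}
    {P : CAS.Setup N k e Sec Word} {R : CAS.Execution P} (hN : 2 ≤ N) (hk : k + 2 * e ≤ N)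
    (hF : R.Fair) :
    ∃ n₁, R.WithinCycles 0 6 n₁ ∧ (∀ i, ¬ R.SuffixIncludes n₁ i 0) ∧
      ∃ n₂, R.WithinCycles n₁ 6 n₂ ∧
        ∀ i b, R.IsWriteOp i b → R.SuffixIncludes n₂ i b → R.ValidWrite i b := by
  obtain ⟨cyc, hc⟩ := hF.exists_isCycleSeq hN hk
  have hfirst : R.WithinCycles 0 6 (cyc 6) := by simpa only [hc.zero] using hc.withinCycles 0 6
  refine ⟨cyc 6, hfirst, fun i h => ?_, cyc 12, hc.withinCycles 6 6, fun i b hwrite h => ?_⟩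
  · exact Nat.not_lt_zero _ (hc.lt_of_suffixIncludes (t := 0) h)
  · exact hc.validWrite (hc.lt_of_suffixIncludes (t := 6) h) hwrite

theorem mainTheorem3 :
    ∃ C₁ C₂ : ℕ, ∀ (N k e f : ℕ) [NeZero N] (Sec : Type u) (Word : Type v),
      2 ≤ N → 1 ≤ k → k + 2 * (f + e) ≤ N →
      ∀ (P : CAS.Setup N k e Sec Word) (R : CAS.Execution P), R.Fair → R.Legal →
        ∃ n₁, R.WithinCycles 0 C₁ n₁ ∧
          (∀ i : Fin N, ¬ R.SuffixIncludes n₁ i 0) ∧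
          ∃ n₂, R.WithinCycles n₁ C₂ n₂ ∧
            ∀ (i : Fin N) (b : ℕ), R.IsWriteOp i b → R.SuffixIncludes n₂ i b →
              R.ValidWrite i b :=
  ⟨6, 6, fun _ _ _ _ _ _ _ hN _ hk _ _ hF _ => mainTheorem3_general hN (by omega) hF⟩
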